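/- Setting. Consider the unicycle in polar coordinates, with state $\Xi=(\rho,\delta,\gamma)$ and inputs $v,\omega$, $$\dot\Xi=\bar g_1(\Xi)\frac v\rho+g_2(\Xi)\,\omega,\qquad \bar g_1(\Xi)=\begin{bmatrix}-\rho\cos\gamma\\ \sin\gamma\\ \sin\gamma\end{bmatrix},\quad g_2=\begin{bmatrix}0\\0\\-1\end{bmatrix},$$ on one of the state spaces $\mathcal Q=\{\rho>0\}\times\mathcal T$, where $\mathcal T$ is one of $\{\delta\in\mathbb R,\gamma\in\mathbb R\}$, $\{\delta\in\mathbb R,|\gamma|<\pi\}$, $\{|\delta|<\pi,\gamma\in\mathbb R\}$, $\{|\delta|<\pi,|\gamma|<\pi\}$ (the spaces $\mathcal S,\mathcal S_1,\mathcal S_2,\mathcal S_3$). Write $\overline{\mathcal Q}=\{\rho\ge0\}\times\mathcal T$. The size $|\Xi|_{\mathcal Q}$ is $\sqrt{\rho^2+\delta^2+\gamma^2}$, where $\delta$ (resp. $\gamma$) is replaced by $2\tan(\delta/2)$ (resp. $2\tan(\gamma/2)$) if $|\delta|<\pi$ (resp. $|\gamma|<\pi$) is imposed in $\mathcal T$.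 Trajectories are Carathéodory solutions that stay in $\mathcal Q$. A function $f$ is of class $\mathcal K_\infty[0,a)$, $0<a\le\infty$, if it is continuous and strictly increasing on $[0,a)$, $f(0)=0$ and $f(r)\to\infty$ as $r\to a$. Class $\mathcal{KL}$ consists of the $\beta(s,t)$, $s,t\ge 0$, that are continuous, strictly increasing and zero at zero in $s$, and nonincreasing with limit $0$ in $t$. A globally strict CLF on $\mathcal Q$ (with respect to the input pair $(v/\rho,\omega)$) is a $C^1$ function $V:\overline{\mathcal Q}\to\mathbb R$ such that $\alpha_1(|\Xi|_{\mathcal Q})\le V(\Xi)\le\alpha_2(|\Xi|_{\mathcal Q})$ on $\overline{\mathcal Q}$ for some $\alpha_1,\alpha_2\in\mathcal K_\infty[0,\infty)$, and such that for every $\Xi\in\overline{\mathcal Q}\setminus\{0\}$ there are $u_1,u_2\in\mathbb R$ with $L_{\bar g_1}V(\Xi)u_1+L_{g_2}V(\Xi)u_2<0$. A feedback law is forward complete on $\mathcal Q$ if from every initial condition in $\mathcal Q$ there is a closed-loop trajectory in $\mathcal Q$ on $[0,\infty)$, and every closed-loop trajectory in $\mathcal Q$ on a bounded interval $[0,T)$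 extends to one on $[0,\infty)$. It renders the point $\rho=\delta=\gamma=0$ globally asymptotically stable (GAS) on $\mathcal Q$ if it is forward complete on $\mathcal Q$ and there is $\beta\in\mathcal{KL}$ such that every closed-loop trajectory in $\mathcal Q$ satisfies $|\Xi(t)|_{\mathcal Q}\le\beta(|\Xi(0)|_{\mathcal Q},t)$ for all $t\ge0$. Theorem. Let $\mathcal Q\in\{\mathcal S,\mathcal S_1,\mathcal S_2,\mathcal S_3\}$, let $V$ be a globally strict CLF on $\mathcal Q$, and put $\nu_1=L_{\bar g_1}V$, $\nu_2=L_{g_2}V$. For $i=1,2$ let $0<a_i\le\infty$, let $\eta_i$ be differentiable on $[0,a_i)$ with $\eta_i$ and $\eta_i'$ of class $\mathcal K_\infty[0,a_i)$, let $\ell\eta_i(r)=\int_0^r(\eta_i')^{-1}(s)\,ds$ be its Legendre–Fenchel transform, and let $\varepsilon_i:\overline{\mathcal Q}\to(0,\infty)$ be continuous. Put $\eta_i(r)=+\infty$ for $r\ge a_i$. (a) The feedback law $$v^*=-\rho\,\varepsilon_1(\eta_1')^{-1}(\varepsilon_1|\nu_1|)\,\mathrm{sgn}(\nu_1),\qquad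 \omega^*=-\varepsilon_2(\eta_2')^{-1}(\varepsilon_2|\nu_2|)\,\mathrm{sgn}(\nu_2)$$ minimizes, for all initial conditions in $\mathcal Q$, the cost $$J=\int_0^\infty\Bigl[\ell\eta_1(\varepsilon_1|\nu_1|)+\ell\eta_2(\varepsilon_2|\nu_2|)+\eta_1\Bigl(\frac{|v|}{\varepsilon_1\rho}\Bigr)+\eta_2\Bigl(\frac{|\omega|}{\varepsilon_2}\Bigr)\Bigr]dt\in[0,\infty].$$ That is, it is forward complete on $\mathcal Q$, and each of its closed-loop trajectories on $[0,\infty)$ has a finite cost, which is at most the cost of every pair of measurable input signals $(v,\omega)$ together with a corresponding trajectory in $\mathcal Q$ on $[0,\infty)$ from the same initial condition. (b) The feedback law $$v=-\rho\,\varepsilon_1\frac{\ell\eta_1(\varepsilon_1|\nu_1|)}{\varepsilon_1|\nu_1|}\,\mathrm{sgn}(\nu_1),\qquad \omega=-\varepsilon_2\frac{\ell\eta_2(\varepsilon_2|\nu_2|)}{\varepsilon_2|\nu_2|}\,\mathrm{sgn}(\nu_2)$$ (a component being $0$ where the corresponding $\nu_i=0$) is continuous as a function of $(\nu_1,\nu_2)\in\mathbb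 R^2$ at each fixed state in $\overline{\mathcal Q}$, is continuous as a function of the state on $\overline{\mathcal Q}$, and renders the point $\rho=\delta=\gamma=0$ GAS on $\mathcal Q$. -/

import Mathlib

open MeasureTheory Set Filter Topology

noncomputable section

namespace Unicycle

/-- The interval `[0, a)` of real numbers, where `a` may be `⊤` (that is, `+∞`). -/
def halfOpen (a : EReal) : Set ℝ := {r | 0 ≤ r ∧ (r : EReal) < a}

/-! ### Comparison functions -/

/-- Class `𝒦∞[0, a)`: continuous and strictly increasing on `[0, a)`, zero at zero, and
unbounded (being increasing, such a function tends to `+∞` at `a`). -/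
structure IsClassKInf (a : EReal) (f : ℝ → ℝ) : Prop where
  continuousOn : ContinuousOn f (halfOpen a)
  strictMonoOn : StrictMonoOn f (halfOpen a)
  map_zero : f 0 = 0
  unbounded : ∀ M : ℝ, ∃ r ∈ halfOpen a, M < f r

/-- Class `𝒦`: continuous and strictly increasing on `[0, ∞)`, zero at zero. -/
structure IsClassK (f : ℝ → ℝ) : Prop where
  continuousOn : ContinuousOn f (Ici 0)
  strictMonoOn : StrictMonoOn f (Ici 0)
  map_zero : f 0 = 0

/-- Class `𝒦ℒ`: of class `𝒦` in the first argument, and decreasing to zero in the second. -/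
structure IsClassKL (β : ℝ → ℝ → ℝ) : Prop where
  classK : ∀ t, 0 ≤ t → IsClassK (fun s => β s t)
  antitoneOn : ∀ s, 0 ≤ s → AntitoneOn (β s) (Ici 0)
  tendsto_zero : ∀ s, 0 ≤ s → Tendsto (β s) atTop (𝓝 0)

/-! ### The Legendre–Fenchel transform -/

/-- The derivative `η'` on `[0, a)`; it is one-sided at `0`. -/
def dEta (a : EReal) (η : ℝ → ℝ) : ℝ → ℝ := derivWithin η (halfOpen a)

/-- `η` is a differentiable function on `[0, a)` such that `η` and `η'` are both of class
`𝒦∞[0, a)`. -/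
structure IsControlPenalty (a : EReal) (η : ℝ → ℝ) : Prop where
  differentiableOn : DifferentiableOn ℝ η (halfOpen a)
  classKInf : IsClassKInf a η
  classKInf_deriv : IsClassKInf a (dEta a η)

/-- The inverse function `(η')⁻¹ : [0, ∞) → [0, a)` of `η'`. -/
def dEtaInv (a : EReal) (η : ℝ → ℝ) : ℝ → ℝ := Function.invFunOn (dEta a η) (halfOpen a)

/-- The Legendre–Fenchel transform `ℓη(r) = ∫₀ʳ (η')⁻¹(s) ds`. -/
def legendre (a : EReal) (η : ℝ → ℝ) (r : ℝ) : ℝ := ∫ s in (0 : ℝ)..r, dEtaInv a η s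

/-! ### The unicycle in polar coordinates -/

/-- States `Ξ = (ρ, δ, γ)`. -/
abbrev State : Type := ℝ × ℝ × ℝ

/-- The vector field `ḡ₁(Ξ) = (-ρ cos γ, sin γ, sin γ)`. -/
def g1 (Ξ : State) : State :=
  (-Ξ.1 * Real.cos Ξ.2.2, Real.sin Ξ.2.2, Real.sin Ξ.2.2)

/-- The vector field `g₂(Ξ) = (0, 0, -1)`. -/
def g2 (_Ξ : State) : State := (0, 0, -1)

/-- The right-hand side `ḡ₁(Ξ) v / ρ + g₂(Ξ) ω`. -/
def field (Ξ : State) (v ω : ℝ) : State := (v / Ξ.1) • g1 Ξ + ω • g2 Ξ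

/-- Labels of the four state spaces. -/
inductive Space where
  | S
  | S₁
  | S₂
  | S₃

/-- The range of the polar angle `δ`. -/
def Space.deltaRange : Space → Set ℝ
  | .S => univ
  | .S₁ => univ
  | .S₂ => Ioo (-Real.pi) Real.pi
  | .S₃ => Ioo (-Real.pi) Real.pi

/-- The range of the line-of-sight angle `γ`. -/
def Space.gammaRange : Space → Set ℝ
  | .S => univ
  | .S₁ => Ioo (-Real.pi) Real.pi
  | .S₂ => univ
  | .S₃ => Ioo (-Real.pi) Real.pi

/-- The state space `{ρ > 0} × 𝒯`. -/
def Space.carrier (Q : Space) : Set State := Ioi 0 ×ˢ (Q.deltaRange ×ˢ Q.gammaRange)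

/-- The extended state space `{ρ ≥ 0} × 𝒯`, which contains the target point `0`. -/
def Space.extended (Q : Space) : Set State := Ici 0 ×ˢ (Q.deltaRange ×ˢ Q.gammaRange)

/-- The coordinate in which `δ` is measured: `2 tan (δ/2)` if `|δ| < π` is imposed, else `δ`. -/
def Space.deltaCoord : Space → ℝ → ℝ
  | .S, δ => δ
  | .S₁, δ => δ
  | .S₂, δ => 2 * Real.tan (δ / 2)
  | .S₃, δ => 2 * Real.tan (δ / 2)

/-- The coordinate in which `γ` is measured: `2 tan (γ/2)` if `|γ| < π` is imposed, else `γ`. -/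
def Space.gammaCoord : Space → ℝ → ℝ
  | .S, γ => γ
  | .S₁, γ => 2 * Real.tan (γ / 2)
  | .S₂, γ => γ
  | .S₃, γ => 2 * Real.tan (γ / 2)

/-- The size `|(ρ, δ, γ)|_𝒬` of a state: it vanishes only at the target point and blows up at
infinity and at the angular boundary of `𝒬`. -/
def Space.size (Q : Space) (Ξ : State) : ℝ :=
  √(Ξ.1 ^ 2 + Q.deltaCoord Ξ.2.1 ^ 2 + Q.gammaCoord Ξ.2.2 ^ 2)

/-! ### Control Lyapunov functions -/

/-- The Lie derivative `L_g V` on the extended state space (one-sided in `ρ` at `ρ = 0`). -/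
def lieDeriv (Q : Space) (V : State → ℝ) (g : State → State) (Ξ : State) : ℝ :=
  fderivWithin ℝ V Q.extended Ξ (g Ξ)

/-- `V` is a globally strict control Lyapunov function on `𝒬` with respect to the input pair
`(v/ρ, ω)`: it is continuously differentiable, positive definite and proper, and at every state
other than the target some value `(u₁, u₂)` of the input pair makes `V` strictly decrease. -/
structure IsStrictCLF (Q : Space) (V : State → ℝ) : Prop where
  contDiffOn : ContDiffOn ℝ 1 V Q.extended
  bounds : ∃ α₁ α₂ : ℝ → ℝ, IsClassKInf ⊤ α₁ ∧ IsClassKInf ⊤ α₂ ∧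
    ∀ Ξ ∈ Q.extended, α₁ (Q.size Ξ) ≤ V Ξ ∧ V Ξ ≤ α₂ (Q.size Ξ)
  decrease : ∀ Ξ ∈ Q.extended, Ξ ≠ 0 →
    ∃ u₁ u₂ : ℝ, lieDeriv Q V g1 Ξ * u₁ + lieDeriv Q V g2 Ξ * u₂ < 0

/-! ### Trajectories and stability -/

/-- `Ξ` is a (Carathéodory) trajectory in `𝒬`, on the time interval `[0, T)`, of the system
`dΞ/dt = ḡ₁(Ξ) v/ρ + g₂(Ξ) ω` with the input signals `v`, `ω`. -/
structure IsTrajectory (Q : Space) (T : EReal) (Ξ : ℝ → State) (v ω : ℝ → ℝ) : Prop where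
  aemeasurable_v : AEMeasurable v (volume.restrict (halfOpen T))
  aemeasurable_ω : AEMeasurable ω (volume.restrict (halfOpen T))
  mem : ∀ t ∈ halfOpen T, Ξ t ∈ Q.carrier
  integrable : ∀ t ∈ halfOpen T,
    IntervalIntegrable (fun s => field (Ξ s) (v s) (ω s)) volume 0 t
  eq_integral : ∀ t ∈ halfOpen T, Ξ t = Ξ 0 + ∫ s in (0 : ℝ)..t, field (Ξ s) (v s) (ω s)

/-- `Ξ` is a trajectory on `[0, T)` of the closed loop under the feedback law
`(v, ω) = k(Ξ)`. -/
def IsClosedLoop (Q : Space) (k : State → ℝ × ℝ) (T : EReal) (Ξ : ℝ → State) : Prop :=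
  IsTrajectory Q T Ξ (fun t => (k (Ξ t)).1) (fun t => (k (Ξ t)).2)

/-- From every initial condition in `𝒬` there is a closed-loop trajectory in `𝒬` on `[0, ∞)`,
and every closed-loop trajectory in `𝒬` on a bounded interval extends to one. -/
def IsForwardComplete (Q : Space) (k : State → ℝ × ℝ) : Prop :=
  (∀ Ξ₀ ∈ Q.carrier, ∃ Ξ : ℝ → State, Ξ 0 = Ξ₀ ∧ IsClosedLoop Q k ⊤ Ξ) ∧
  ∀ (T : ℝ) (Ξ : ℝ → State), 0 < T → IsClosedLoop Q k T Ξ →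
    ∃ Ξ' : ℝ → State, IsClosedLoop Q k ⊤ Ξ' ∧ EqOn Ξ Ξ' (halfOpen T)

/-- The feedback `k` renders the point `ρ = δ = γ = 0` globally asymptotically stable on `𝒬`. -/
def IsGAS (Q : Space) (k : State → ℝ × ℝ) : Prop :=
  IsForwardComplete Q k ∧
  ∃ β : ℝ → ℝ → ℝ, IsClassKL β ∧ ∀ Ξ : ℝ → State, IsClosedLoop Q k ⊤ Ξ →
    ∀ t, 0 ≤ t → Q.size (Ξ t) ≤ β (Q.size (Ξ 0)) t

/-! ### The cost functional and its minimization -/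

/-- The penalty `η(r)` on a control magnitude `r ≥ 0`, infinite outside the domain `[0, a)`. -/
def penalty (a : EReal) (η : ℝ → ℝ) (r : ℝ) : ENNReal :=
  open Classical in if (r : EReal) < a then ENNReal.ofReal (η r) else ⊤

/-- The data of the design: a function `V` on a state space, the functions `ηᵢ` on `[0, aᵢ)`,
and the scaling functions `εᵢ`. -/
structure Design where
  Q : Space
  V : State → ℝ
  a₁ : EReal
  a₂ : EReal
  η₁ : ℝ → ℝ
  η₂ : ℝ → ℝ
  ε₁ : State → ℝ
  ε₂ : State → ℝ

namespace Design

/-- `ν₁ = L_{ḡ₁} V`. -/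
def ν₁ (D : Design) : State → ℝ := lieDeriv D.Q D.V g1

/-- `ν₂ = L_{g₂} V`. -/
def ν₂ (D : Design) : State → ℝ := lieDeriv D.Q D.V g2

/-- The running cost on the state, `l = ℓη₁(ε₁|ν₁|) + ℓη₂(ε₂|ν₂|)`. -/
def stateCost (D : Design) (Ξ : State) : ℝ :=
  legendre D.a₁ D.η₁ (D.ε₁ Ξ * |D.ν₁ Ξ|) + legendre D.a₂ D.η₂ (D.ε₂ Ξ * |D.ν₂ Ξ|)

/-- The cost `J = ∫₀^∞ [l(Ξ) + η₁(|v|/(ε₁ρ)) + η₂(|ω|/ε₂)] dt`, with values in `[0, ∞]`. -/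
def cost (D : Design) (Ξ : ℝ → State) (v ω : ℝ → ℝ) : ENNReal :=
  ∫⁻ t in Ici (0 : ℝ), (ENNReal.ofReal (D.stateCost (Ξ t)) +
    penalty D.a₁ D.η₁ (|v t| / (D.ε₁ (Ξ t) * (Ξ t).1)) +
    penalty D.a₂ D.η₂ (|ω t| / D.ε₂ (Ξ t)))

/-- The law `(v*, ω*)` built from `(ηᵢ')⁻¹`. -/
def optimalFeedback (D : Design) (Ξ : State) : ℝ × ℝ :=
  (-Ξ.1 * D.ε₁ Ξ * dEtaInv D.a₁ D.η₁ (D.ε₁ Ξ * |D.ν₁ Ξ|) * Real.sign (D.ν₁ Ξ),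
    -D.ε₂ Ξ * dEtaInv D.a₂ D.η₂ (D.ε₂ Ξ * |D.ν₂ Ξ|) * Real.sign (D.ν₂ Ξ))

/-- The law built from `ℓηᵢ(r)/r`, as a function of the values `n = (ν₁, ν₂)` at a fixed state
(it is read as `0` in a component where `νᵢ = 0`). -/
def stabilizingLaw (D : Design) (Ξ : State) (n : ℝ × ℝ) : ℝ × ℝ :=
  (-Ξ.1 * D.ε₁ Ξ * (legendre D.a₁ D.η₁ (D.ε₁ Ξ * |n.1|) / (D.ε₁ Ξ * |n.1|)) * Real.sign n.1,
    -D.ε₂ Ξ * (legendre D.a₂ D.η₂ (D.ε₂ Ξ * |n.2|) / (D.ε₂ Ξ * |n.2|)) * Real.sign n.2)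

/-- The feedback law built from `ℓηᵢ(r)/r`. -/
def stabilizingFeedback (D : Design) (Ξ : State) : ℝ × ℝ :=
  D.stabilizingLaw Ξ (D.ν₁ Ξ, D.ν₂ Ξ)

/-- The feedback `k` minimizes the cost for all initial conditions in `𝒬`: the closed loop is
forward complete, and each of its trajectories has a finite cost, which no pair of input signals
and trajectory in `𝒬` from the same initial condition improves on. -/
def IsMinimizedBy (D : Design) (k : State → ℝ × ℝ) : Prop :=
  IsForwardComplete D.Q k ∧
  ∀ Ξ : ℝ → State, IsClosedLoop D.Q k ⊤ Ξ →
    D.cost Ξ (fun t => (k (Ξ t)).1) (fun t => (k (Ξ t)).2) < ⊤ ∧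
    ∀ (Ξ' : ℝ → State) (v ω : ℝ → ℝ), IsTrajectory D.Q ⊤ Ξ' v ω → Ξ' 0 = Ξ 0 →
      D.cost Ξ (fun t => (k (Ξ t)).1) (fun t => (k (Ξ t)).2) ≤ D.cost Ξ' v ω

end Design

end Unicycle

end

/-!
Both feedback laws have the form `v = ρ u₁(Ξ)`, `ω = u₂(Ξ)` with `u₁`, `u₂` continuous on the
extended state space and `ν₁ u₁ + ν₂ u₂ < 0` away from the target (`IsDescentFeedback`): they are
odd continuous functions of `εᵢ νᵢ`, multiplied by `-εᵢ`, and `ν₁`, `ν₂` have no common zero other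
than the target because `V` is a strict control Lyapunov function. Forward completeness and
asymptotic stability hold for every such law.

*Forward completeness.* The closed-loop vector field is only continuous, so existence is Peano's
theorem (`exists_solution_of_continuous`: Euler polygons and the Arzelà–Ascoli theorem). Sublevel
sets of `V` are compact in the extended state space, since the size is proper, and `V` decreases
along solutions; hence the field is bounded along each of them. As `ρ' = -ρ u₁ cos γ`, the distance
`ρ` decays at most exponentially, so a solution cannot leave `𝒬` in finite time
(`IsDescentFeedback.isForwardComplete`).

*Asymptotic stability.* By compactness, `V` decreases at a uniform rate while it lies between two
positive levels. This gives a uniform bound, uniform stability and uniform attractivity, and any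
family of functions with these properties has a common bound of class `𝒦ℒ`
(`exists_isClassKL_bound`).

*Optimality.* The Fenchel–Young inequality `b x ≤ η x + ℓη(b)`, an equality at `x = (η')⁻¹(b)`,
shows that the running cost is at least `|dV/dt|` along any trajectory, and equals `-dV/dt` along the
optimal closed loop. The cost of the latter is therefore at most `V(Ξ(0))`. A competitor of cost
`J < V(Ξ(0))` would keep `V` between the positive levels `V(Ξ(0)) - J` and `V(Ξ(0)) + J`, where the
state cost is bounded below by a positive constant, and so would have infinite cost
(`Design.IsAdmissible.ofReal_le_cost`). Competitors are merely absolutely continuous, so `dV/dt` is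
integrated by means of the Lebesgue differentiation theorem (`integral_fderiv_comp_eq_sub`).
-/

noncomputable section

namespace Unicycle

/-! ### Existence of solutions of differential equations with a continuous right-hand side -/

section Peano

variable {E : Type*} [NormedAddCommGroup E] [NormedSpace ℝ E] [FiniteDimensional ℝ E]

/-- The nodes of the Euler polygon of step `h` for `x' = G x`. -/
def eulerNode (G : E → E) (x₀ : E) (h : ℝ) : ℕ → E
  | 0 => x₀
  | n + 1 => eulerNode G x₀ h n + h • G (eulerNode G x₀ h n)

/-- The velocity of the Euler polygon, a step function of time. -/
def eulerVelocity (G : E → E) (x₀ : E) (h : ℝ) (s : ℝ) : E :=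
  G (eulerNode G x₀ h ⌊s / h⌋₊)

/-- The Euler polygon of step `h`; for negative times it moves with the initial velocity. -/
def eulerPolygon (G : E → E) (x₀ : E) (h : ℝ) (t : ℝ) : E :=
  x₀ + ∫ s in (0 : ℝ)..t, eulerVelocity G x₀ h s

variable {G : E → E} {x₀ : E} {h M : ℝ}

lemma intervalIntegrable_eulerVelocity (hM : ∀ x, ‖G x‖ ≤ M) (a b : ℝ) :
    IntervalIntegrable (eulerVelocity G x₀ h) volume a b := by
  borelize E
  have hmeas : Measurable (eulerVelocity G x₀ h) :=
    (measurable_from_nat (f := fun n => G (eulerNode G x₀ h n))).comp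
      (Nat.measurable_floor.comp (measurable_id.div_const h))
  have : IntervalIntegrable (fun _ : ℝ => M) volume a b := intervalIntegrable_const
  exact this.mono_fun hmeas.aestronglyMeasurable
    (ae_of_all _ fun s => (hM _).trans (le_abs_self M))

lemma eulerPolygon_sub (hM : ∀ x, ‖G x‖ ≤ M) (s t : ℝ) :
    eulerPolygon G x₀ h t - eulerPolygon G x₀ h s = ∫ r in s..t, eulerVelocity G x₀ h r := by
  rw [eulerPolygon, eulerPolygon, add_sub_add_left_eq_sub,
    intervalIntegral.integral_interval_sub_left] <;> exact intervalIntegrable_eulerVelocity hM _ _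

lemma norm_eulerPolygon_sub_le (hM : ∀ x, ‖G x‖ ≤ M) (s t : ℝ) :
    ‖eulerPolygon G x₀ h t - eulerPolygon G x₀ h s‖ ≤ M * |t - s| := by
  rw [eulerPolygon_sub hM]
  exact intervalIntegral.norm_integral_le_of_norm_le_const fun r _ => hM _

lemma eulerPolygon_nat_mul (hM : ∀ x, ‖G x‖ ≤ M) (hh : 0 < h) (n : ℕ) :
    eulerPolygon G x₀ h (n * h) = eulerNode G x₀ h n := by
  induction n with
  | zero => simp [eulerPolygon, eulerNode]
  | succ n ih =>
    have hle : (n : ℝ) * h ≤ ((n + 1 : ℕ) : ℝ) * h := by push_cast; nlinarith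
    have key : ∫ r in (n * h)..((n + 1 : ℕ) * h), eulerVelocity G x₀ h r
        = ∫ r in (n * h)..((n + 1 : ℕ) * h), G (eulerNode G x₀ h n) := by
      rw [intervalIntegral.integral_of_le hle, intervalIntegral.integral_of_le hle,
        integral_Ioc_eq_integral_Ioo, integral_Ioc_eq_integral_Ioo]
      refine setIntegral_congr_fun measurableSet_Ioo fun r hr => ?_
      have : ⌊r / h⌋₊ = n := by
        have hr1 := hr.1
        have hr2 := hr.2
        have h0 : 0 ≤ r := le_trans (by positivity) hr1.le
        rw [Nat.floor_eq_iff (by positivity), le_div_iff₀ hh, div_lt_iff₀ hh]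
        push_cast at hr2
        exact ⟨hr1.le, hr2⟩
      simp only [eulerVelocity, this]
    have := eulerPolygon_sub (x₀ := x₀) (h := h) hM (n * h) ((n + 1 : ℕ) * h)
    rw [key, intervalIntegral.integral_const, ih, sub_eq_iff_eq_add] at this
    rw [this, eulerNode, add_comm]
    push_cast
    ring_nf

lemma norm_eulerPolygon_sub_node_le (hM : ∀ x, ‖G x‖ ≤ M) (hh : 0 < h) {t : ℝ} (ht : 0 ≤ t) :
    ‖eulerPolygon G x₀ h t - eulerNode G x₀ h ⌊t / h⌋₊‖ ≤ M * h := by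
  rw [← eulerPolygon_nat_mul hM hh]
  have hM0 : 0 ≤ M := (norm_nonneg _).trans (hM 0)
  refine (norm_eulerPolygon_sub_le hM _ _).trans (mul_le_mul_of_nonneg_left ?_ hM0)
  have h1 : (⌊t / h⌋₊ : ℝ) * h ≤ t := by
    rw [← le_div_iff₀ hh]; exact Nat.floor_le (by positivity)
  have h2 : t < (⌊t / h⌋₊ + 1 : ℝ) * h := by
    rw [← div_lt_iff₀ hh]; exact Nat.lt_floor_add_one _
  rw [abs_le]
  constructor <;> nlinarith

/-- Functions with a common Lipschitz constant and a common value at `0` form a compact set, in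
the topology of locally uniform convergence. -/
lemma isCompact_lipschitz (K : NNReal) (x₀ : E) :
    IsCompact {X : C(ℝ, E) | LipschitzWith K X ∧ X 0 = x₀} := by
  refine ArzelaAscoli.isCompact_of_equicontinuous _ ?_ ?_
  · have himage : ContinuousMap.toFun '' {X : C(ℝ, E) | LipschitzWith K X ∧ X 0 = x₀}
        = {X : ℝ → E | (∀ s t, dist (X s) (X t) ≤ K * dist s t) ∧ X 0 = x₀} := by
      ext X
      constructor
      · rintro ⟨Y, ⟨hY, hY0⟩, rfl⟩
        exact ⟨fun s t => hY.dist_le_mul s t, hY0⟩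
      · rintro ⟨h1, h2⟩
        have hL : LipschitzWith K X := LipschitzWith.of_dist_le_mul h1
        exact ⟨⟨X, hL.continuous⟩, ⟨hL, h2⟩, rfl⟩
    rw [himage]
    refine (isCompact_univ_pi fun t : ℝ =>
      isCompact_closedBall x₀ ((K : ℝ) * dist t 0)).of_isClosed_subset ?_ ?_
    · simp only [Set.ofPred_and, Set.ofPred_forall]
      refine IsClosed.inter (isClosed_iInter fun s => isClosed_iInter fun t => ?_) ?_
      · exact isClosed_le ((continuous_apply s).dist (continuous_apply t)) continuous_const
      · exact isClosed_eq (continuous_apply 0) continuous_const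
    · rintro X ⟨h1, h2⟩ t -
      simpa [Metric.mem_closedBall, ← h2] using h1 t 0
  · refine LipschitzWith.uniformEquicontinuous _ K ?_ |>.equicontinuous
    exact fun X => X.2.1

/-- **Peano's existence theorem** for a bounded continuous autonomous right-hand side. -/
theorem exists_solution_of_continuous (hG : Continuous G) (hM : ∀ x, ‖G x‖ ≤ M) (x₀ : E) :
    ∃ X : ℝ → E, Continuous X ∧ ∀ t, 0 ≤ t → X t = x₀ + ∫ s in (0 : ℝ)..t, G (X s) := by
  have hM0 : 0 ≤ M := (norm_nonneg _).trans (hM 0)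
  have hL : ∀ h : ℝ, LipschitzWith M.toNNReal (eulerPolygon G x₀ h) := fun h =>
    LipschitzWith.of_dist_le_mul fun s t => by
      rw [dist_eq_norm, Real.dist_eq, Real.coe_toNNReal _ hM0]
      exact norm_eulerPolygon_sub_le hM t s
  let h : ℕ → ℝ := fun n => 1 / ((n : ℝ) + 1)
  have hh : ∀ n, 0 < h n := fun n => by positivity
  have hh0 : Tendsto h atTop (𝓝 0) := tendsto_one_div_add_atTop_nhds_zero_nat
  let X : ℕ → C(ℝ, E) := fun n => ⟨eulerPolygon G x₀ (h n), (hL _).continuous⟩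
  obtain ⟨Y, -, φ, hφ, hlim⟩ := (isCompact_lipschitz M.toNNReal x₀).tendsto_subseq (x := X)
    fun n => ⟨hL _, by simp [X, eulerPolygon]⟩
  have hpt : ∀ t, Tendsto (fun n => eulerPolygon G x₀ (h (φ n)) t) atTop (𝓝 (Y t)) := fun t =>
    ((continuous_eval_const (F := C(ℝ, E)) t).tendsto Y).comp hlim
  have hhφ : Tendsto (fun n => h (φ n)) atTop (𝓝 0) := hh0.comp hφ.tendsto_atTop
  have hnode : ∀ t, 0 ≤ t →
      Tendsto (fun n => eulerVelocity G x₀ (h (φ n)) t) atTop (𝓝 (G (Y t))) := by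
    intro t ht
    refine (hG.tendsto _).comp ?_
    have hdiff : Tendsto (fun n => eulerPolygon G x₀ (h (φ n)) t
        - eulerNode G x₀ (h (φ n)) ⌊t / h (φ n)⌋₊) atTop (𝓝 0) := by
      refine squeeze_zero_norm (fun n => norm_eulerPolygon_sub_node_le hM (hh _) ht) ?_
      simpa using hhφ.const_mul M
    simpa using (hpt t).sub hdiff
  refine ⟨Y, Y.continuous, fun t ht => tendsto_nhds_unique (hpt t) ?_⟩
  refine Tendsto.const_add x₀ ?_
  refine intervalIntegral.tendsto_integral_filter_of_dominated_convergence (fun _ => M) ?_ ?_ ?_ ?_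
  · exact Eventually.of_forall fun n =>
      (intervalIntegrable_iff.1 (intervalIntegrable_eulerVelocity hM 0 t)).aestronglyMeasurable
  · exact Eventually.of_forall fun n => ae_of_all _ fun s _ => hM _
  · exact intervalIntegrable_const
  · refine ae_of_all _ fun s hs => hnode s ?_
    rw [uIoc_of_le ht] at hs
    exact hs.1.le

end Peano

/-! ### The chain rule along absolutely continuous curves -/

section ChainRule

variable {E : Type*} [NormedAddCommGroup E] [NormedSpace ℝ E] [FiniteDimensional ℝ E]

/-- Integrated chain rule for a `C¹` function along a curve that is the primitive of an integrable
function. The composition is absolutely continuous because `V` is Lipschitz on the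
image of the curve, which is compact. -/
theorem integral_fderiv_comp_eq_sub {U : Set E} (hU : IsOpen U) {V : E → ℝ}
    (hV : ContDiffOn ℝ 1 V U) {X F : ℝ → E} {T : ℝ} (hT : 0 ≤ T)
    (hF : IntervalIntegrable F volume 0 T)
    (hX : ∀ t ∈ Icc 0 T, X t = X 0 + ∫ s in (0 : ℝ)..t, F s) (hXU : ∀ t ∈ Icc 0 T, X t ∈ U) :
    IntervalIntegrable (fun t => fderiv ℝ V (X t) (F t)) volume 0 T ∧
      ∫ t in (0 : ℝ)..T, fderiv ℝ V (X t) (F t) = V (X T) - V (X 0) := by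
  have hXcont : ContinuousOn X (Icc 0 T) := by
    have h1 := intervalIntegral.continuousOn_primitive_interval' hF (left_mem_uIcc)
    rw [uIcc_of_le hT] at h1
    exact (continuousOn_const.add h1).congr hX
  have hXC : ∀ t ∈ Icc 0 T, X t ∈ X '' Icc 0 T := fun t ht => mem_image_of_mem _ ht
  have hdiff : ∀ x ∈ U, DifferentiableAt ℝ V x := fun x hx =>
    (hV.differentiableOn one_ne_zero).differentiableAt (hU.mem_nhds hx)
  have hloc : LocallyLipschitzOn (X '' Icc 0 T) V := by
    rintro x ⟨t, ht, rfl⟩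
    obtain ⟨K, s, hs, hK⟩ :=
      (hV.contDiffAt (hU.mem_nhds (hXU t ht))).exists_lipschitzOnWith
    exact ⟨K, s, mem_nhdsWithin_of_mem_nhds hs, hK⟩
  obtain ⟨L, hL⟩ := hloc.exists_lipschitzOnWith_of_compact
    (isCompact_Icc.image_of_continuousOn hXcont)
  have hac : AbsolutelyContinuousOnInterval (fun t => V (X t)) 0 T := by
    have h1 := hF.norm.absolutelyContinuousOnInterval_intervalIntegral
      (c := 0) left_mem_uIcc
    rw [AbsolutelyContinuousOnInterval] at h1 ⊢
    have h2 := h1.const_mul (L : ℝ)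
    rw [mul_zero] at h2
    refine squeeze_zero' (Eventually.of_forall fun E => Finset.sum_nonneg fun _ _ => dist_nonneg)
      ?_ h2
    filter_upwards [mem_inf_of_right (mem_principal_self _)] with e he
    rw [Finset.mul_sum]
    refine Finset.sum_le_sum fun i hi => ?_
    obtain ⟨ha, hb⟩ := he.1 i hi
    have hia : IntervalIntegrable F volume 0 (e.2 i).1 :=
      hF.mono_set (uIcc_subset_uIcc left_mem_uIcc ha)
    have hib : IntervalIntegrable F volume 0 (e.2 i).2 :=
      hF.mono_set (uIcc_subset_uIcc left_mem_uIcc hb)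
    rw [uIcc_of_le hT] at ha hb
    refine (hL.dist_le_mul _ (hXC _ ha) _ (hXC _ hb)).trans
      (mul_le_mul_of_nonneg_left ?_ L.2)
    rw [dist_comm, dist_eq_norm, dist_comm, Real.dist_eq, hX _ ha, hX _ hb, add_sub_add_left_eq_sub,
      intervalIntegral.integral_interval_sub_left hib hia,
      intervalIntegral.integral_interval_sub_left hib.norm hia.norm]
    exact intervalIntegral.norm_integral_le_abs_integral_norm
  have hae : ∀ᵐ t, t ∈ Ioc 0 T → deriv (fun t => V (X t)) t = fderiv ℝ V (X t) (F t) := by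
    have hTne : ∀ᵐ t : ℝ, t ≠ T := by simp [ae_iff, measure_singleton]
    filter_upwards [hF.ae_hasDerivAt_integral, hTne] with t ht htT htmem
    have htI : t ∈ Ioo 0 T := ⟨htmem.1, lt_of_le_of_ne htmem.2 htT⟩
    have h1 := (ht (by rw [uIcc_of_le hT]; exact Ioc_subset_Icc_self htmem) 0
      left_mem_uIcc).const_add (X 0)
    have h2 : HasDerivAt X (F t) t := h1.congr_of_eventuallyEq (by
      filter_upwards [Ioo_mem_nhds htI.1 htI.2] with s hs using hX s (Ioo_subset_Icc_self hs))
    exact ((hdiff _ (hXU t (Ioo_subset_Icc_self htI))).hasFDerivAt.comp_hasDerivAt t h2).deriv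
  have hae' : ∀ᵐ t, t ∈ uIoc 0 T → deriv (fun t => V (X t)) t = fderiv ℝ V (X t) (F t) := by
    rwa [uIoc_of_le hT]
  constructor
  · exact hac.intervalIntegrable_deriv.congr_ae ((ae_restrict_iff' measurableSet_uIoc).2 hae')
  · rw [← hac.integral_deriv_eq_sub]
    exact (intervalIntegral.integral_congr_ae hae').symm

end ChainRule

/-! ### From uniform stability and attractivity to a class `𝒦ℒ` bound -/

section ClassKL

/-- The largest value taken after time `t` by the functions of the family `𝓕` that start below
`s` (or `0`, if no such value is positive). -/
def envelope (𝓕 : Set (ℝ → ℝ)) (s t : ℝ) : ℝ :=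
  sSup (insert 0 {y | ∃ x ∈ 𝓕, x 0 ≤ s ∧ ∃ τ, t ≤ τ ∧ y = x τ})

variable {𝓕 : Set (ℝ → ℝ)}

lemma bddAbove_envelope (hbdd : ∀ s, ∃ R, ∀ x ∈ 𝓕, x 0 ≤ s → ∀ t, 0 ≤ t → x t ≤ R)
    (s : ℝ) {t : ℝ} (ht : 0 ≤ t) :
    BddAbove (insert 0 {y | ∃ x ∈ 𝓕, x 0 ≤ s ∧ ∃ τ, t ≤ τ ∧ y = x τ}) := by
  obtain ⟨R, hR⟩ := hbdd s
  refine BddAbove.insert 0 ⟨R, ?_⟩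
  rintro y ⟨x, hx, hxs, τ, hτ, rfl⟩
  exact hR x hx hxs τ (ht.trans hτ)

lemma envelope_le {s t b : ℝ} (hb : 0 ≤ b)
    (h : ∀ x ∈ 𝓕, x 0 ≤ s → ∀ τ, t ≤ τ → x τ ≤ b) : envelope 𝓕 s t ≤ b := by
  refine csSup_le (insert_nonempty _ _) ?_
  rintro y (rfl | ⟨x, hx, hxs, τ, hτ, rfl⟩)
  exacts [hb, h x hx hxs τ hτ]

lemma envelope_nonneg (hbdd : ∀ s, ∃ R, ∀ x ∈ 𝓕, x 0 ≤ s → ∀ t, 0 ≤ t → x t ≤ R)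
    (s : ℝ) {t : ℝ} (ht : 0 ≤ t) : 0 ≤ envelope 𝓕 s t :=
  le_csSup (bddAbove_envelope hbdd s ht) (mem_insert _ _)

lemma le_envelope (hbdd : ∀ s, ∃ R, ∀ x ∈ 𝓕, x 0 ≤ s → ∀ t, 0 ≤ t → x t ≤ R)
    {s t τ : ℝ} (ht : 0 ≤ t) (hτ : t ≤ τ) {x : ℝ → ℝ} (hx : x ∈ 𝓕) (hxs : x 0 ≤ s) :
    x τ ≤ envelope 𝓕 s t :=
  le_csSup (bddAbove_envelope hbdd s ht) (mem_insert_of_mem _ ⟨x, hx, hxs, τ, hτ, rfl⟩)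

lemma envelope_mono (hbdd : ∀ s, ∃ R, ∀ x ∈ 𝓕, x 0 ≤ s → ∀ t, 0 ≤ t → x t ≤ R)
    {t : ℝ} (ht : 0 ≤ t) : Monotone fun s => envelope 𝓕 s t := fun _ s' hs =>
  envelope_le (envelope_nonneg hbdd s' ht) fun _ hx hxs _ hτ =>
    le_envelope hbdd ht hτ hx (hxs.trans hs)

lemma envelope_antitone (hbdd : ∀ s, ∃ R, ∀ x ∈ 𝓕, x 0 ≤ s → ∀ t, 0 ≤ t → x t ≤ R)
    (s : ℝ) : AntitoneOn (envelope 𝓕 s) (Ici 0) := fun _ ht _ _ htt' =>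
  envelope_le (envelope_nonneg hbdd s ht) fun _ hx hxs _ hτ =>
    le_envelope hbdd ht (htt'.trans hτ) hx hxs

/-- A family of functions that is uniformly bounded, uniformly stable and uniformly attracted to
zero has a common bound of class `𝒦ℒ`. The envelope of the family becomes continuous in the initial
value when it is averaged over the interval from `s` to `2 s`, and strictly increasing when
`s e⁻ᵗ` is added. -/
theorem exists_isClassKL_bound (hnonneg : ∀ x ∈ 𝓕, 0 ≤ x 0)
    (hbdd : ∀ s, ∃ R, ∀ x ∈ 𝓕, x 0 ≤ s → ∀ t, 0 ≤ t → x t ≤ R)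
    (hstab : ∀ ε > 0, ∃ δ > 0, ∀ x ∈ 𝓕, x 0 ≤ δ → ∀ t, 0 ≤ t → x t ≤ ε)
    (hattr : ∀ s, ∀ ε > 0, ∃ T, 0 ≤ T ∧ ∀ x ∈ 𝓕, x 0 ≤ s → ∀ t, T ≤ t → x t ≤ ε) :
    ∃ β : ℝ → ℝ → ℝ, IsClassKL β ∧ ∀ x ∈ 𝓕, ∀ t, 0 ≤ t → x t ≤ β (x 0) t := by
  have hint : ∀ {t : ℝ}, 0 ≤ t → ∀ a b : ℝ,
      IntervalIntegrable (fun r => envelope 𝓕 r t) volume a b :=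
    fun ht a b => (envelope_mono hbdd ht).intervalIntegrable
  have hint' : ∀ {s t : ℝ}, 0 ≤ s → 0 ≤ t →
      IntervalIntegrable (fun u => envelope 𝓕 (s * u) t) volume 1 2 := fun hs ht =>
    ((envelope_mono hbdd ht).comp
      (monotone_mul_left_of_nonneg hs)).intervalIntegrable
  have hzero : ∀ {t : ℝ}, 0 ≤ t → envelope 𝓕 0 t = 0 := fun ht => by
    refine le_antisymm (le_of_forall_pos_le_add fun ε hε => ?_) (envelope_nonneg hbdd 0 ht)
    obtain ⟨δ, hδ, h⟩ := hstab ε hε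
    rw [zero_add]
    exact envelope_le hε.le fun x hx hxs τ hτ => h x hx (hxs.trans hδ.le) τ (ht.trans hτ)
  set A : ℝ → ℝ → ℝ := fun s t => ∫ u in (1 : ℝ)..2, envelope 𝓕 (s * u) t with hA
  have hA_nonneg : ∀ {s t : ℝ}, 0 ≤ t → 0 ≤ A s t := fun ht =>
    intervalIntegral.integral_nonneg one_le_two fun u _ => envelope_nonneg hbdd _ ht
  have hA_le : ∀ {s t : ℝ}, 0 ≤ s → 0 ≤ t → A s t ≤ envelope 𝓕 (s * 2) t := fun {s t} hs ht => by
    have := intervalIntegral.integral_mono_on (one_le_two (α := ℝ)) (hint' hs ht)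
      (intervalIntegrable_const (c := envelope 𝓕 (s * 2) t))
      fun u hu => envelope_mono hbdd ht (mul_le_mul_of_nonneg_left hu.2 hs)
    rw [intervalIntegral.integral_const] at this
    norm_num at this
    exact this
  have hle_A : ∀ {s t : ℝ}, 0 ≤ s → 0 ≤ t → envelope 𝓕 s t ≤ A s t := fun {s t} hs ht => by
    have := intervalIntegral.integral_mono_on (one_le_two (α := ℝ))
      (intervalIntegrable_const (c := envelope 𝓕 s t)) (hint' hs ht)
      fun u hu => envelope_mono hbdd ht (le_mul_of_one_le_right hs hu.1)
    rw [intervalIntegral.integral_const] at this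
    norm_num at this
    exact this
  have hA_mono : ∀ {t : ℝ}, 0 ≤ t → MonotoneOn (fun s => A s t) (Ici 0) :=
    fun ht s hs s' hs' hss' => intervalIntegral.integral_mono_on one_le_two
      (hint' hs ht) (hint' hs' ht) fun u hu =>
        envelope_mono hbdd ht (mul_le_mul_of_nonneg_right hss' (zero_le_one.trans hu.1))
  have hsmall : ∀ {t : ℝ}, 0 ≤ t → Tendsto (fun s => A s t) (𝓝[Ici 0] 0) (𝓝 0) := fun {t} ht => by
    rw [Metric.tendsto_nhdsWithin_nhds]
    intro ε hε
    obtain ⟨δ, hδ, h⟩ := hstab (ε / 2) (half_pos hε)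
    refine ⟨δ / 2, half_pos hδ, fun s hs hsδ => ?_⟩
    rw [Real.dist_eq, sub_zero] at hsδ ⊢
    rw [abs_of_nonneg (hA_nonneg ht)]
    have h2 : s ≤ δ / 2 := (le_abs_self s).trans hsδ.le
    have : envelope 𝓕 (s * 2) t ≤ ε / 2 := envelope_le (half_pos hε).le
      fun x hx hxs τ hτ => h x hx (by linarith) τ (ht.trans hτ)
    linarith [hA_le hs ht]
  have hA_cont : ∀ {t : ℝ}, 0 ≤ t → ContinuousOn (fun s => A s t) (Ici 0) := fun {t} ht s hs => by
    rcases (mem_Ici.1 hs).eq_or_lt with rfl | hs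
    · have : A 0 t = 0 := by simp [hA, hzero ht]
      rw [ContinuousWithinAt, this]
      exact hsmall ht
    · have hprim := intervalIntegral.continuous_primitive (hint ht) 0
      have heq : (fun s => A s t) =ᶠ[𝓝 s] fun s => s⁻¹ *
          ((∫ r in (0 : ℝ)..(s * 2), envelope 𝓕 r t) - ∫ r in (0 : ℝ)..s, envelope 𝓕 r t) := by
        filter_upwards [lt_mem_nhds hs] with s' hs'
        rw [intervalIntegral.integral_interval_sub_left (hint ht _ _) (hint ht _ _)]
        simp only [hA]
        rw [intervalIntegral.integral_comp_mul_left (fun r => envelope 𝓕 r t) hs'.ne', mul_one,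
          smul_eq_mul]
      refine ContinuousAt.continuousWithinAt (ContinuousAt.congr ?_ heq.symm)
      refine (continuousAt_inv₀ hs.ne').mul (ContinuousAt.sub ?_ hprim.continuousAt)
      exact (hprim.comp (continuous_id.mul continuous_const)).continuousAt
  refine ⟨fun s t => A s t + s * Real.exp (-t), ⟨fun t ht => ⟨?_, ?_, ?_⟩, ?_, ?_⟩, ?_⟩
  · exact (hA_cont ht).add (continuousOn_id.mul continuousOn_const)
  · intro s hs s' hs' hss'
    exact add_lt_add_of_le_of_lt (hA_mono ht hs hs' hss'.le)
      (mul_lt_mul_of_pos_right hss' (Real.exp_pos _))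
  · simp [hA, hzero ht]
  · intro s hs t ht t' ht' htt'
    refine add_le_add ?_ (mul_le_mul_of_nonneg_left (Real.exp_le_exp.2 (neg_le_neg htt')) hs)
    exact intervalIntegral.integral_mono_on one_le_two (hint' hs ht') (hint' hs ht)
      fun u _ => envelope_antitone hbdd _ ht ht' htt'
  · intro s hs
    have h1 : Tendsto (fun t => A s t) atTop (𝓝 0) := by
      rw [Metric.tendsto_atTop]
      intro ε hε
      obtain ⟨T, hT, h⟩ := hattr (s * 2) (ε / 2) (half_pos hε)
      refine ⟨T, fun t ht => ?_⟩
      have ht0 : 0 ≤ t := hT.trans ht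
      rw [Real.dist_eq, sub_zero, abs_of_nonneg (hA_nonneg ht0)]
      have : envelope 𝓕 (s * 2) t ≤ ε / 2 := envelope_le (half_pos hε).le
        fun x hx hxs τ hτ => h x hx hxs τ (ht.trans hτ)
      linarith [hA_le hs ht0]
    have h2 : Tendsto (fun t => s * Real.exp (-t)) atTop (𝓝 (s * 0)) :=
      (Real.tendsto_exp_neg_atTop_nhds_zero).const_mul s
    simpa using h1.add h2
  · intro x hx t ht
    have h0 := hnonneg x hx
    have h1 := le_envelope hbdd ht le_rfl hx le_rfl
    have h2 : 0 ≤ x 0 * Real.exp (-t) := by positivity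
    linarith [hle_A h0 ht]

end ClassKL

/-! ### The Legendre–Fenchel transform of a control penalty -/

section Penalty

variable {a : EReal} {η : ℝ → ℝ}

lemma mem_halfOpen_top {r : ℝ} : r ∈ halfOpen ⊤ ↔ 0 ≤ r :=
  ⟨fun h => h.1, fun h => ⟨h, EReal.coe_lt_top r⟩⟩

lemma mem_halfOpen_of_le {r s : ℝ} (hs : s ∈ halfOpen a) (hr : 0 ≤ r) (hrs : r ≤ s) :
    r ∈ halfOpen a :=
  ⟨hr, (EReal.coe_le_coe_iff.2 hrs).trans_lt hs.2⟩

lemma exists_gt_mem_halfOpen {r s : ℝ} (hr : r ∈ halfOpen a) (hs : r < s) :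
    ∃ q ∈ halfOpen a, r < q ∧ q < s := by
  obtain ⟨q, hrq, hq⟩ := EReal.lt_iff_exists_real_btwn.1
    (lt_min hr.2 (EReal.coe_lt_coe_iff.2 hs))
  have hrq' : r < q := EReal.coe_lt_coe_iff.1 hrq
  exact ⟨q, ⟨hr.1.trans hrq'.le, hq.trans_le (min_le_left _ _)⟩, hrq',
    EReal.coe_lt_coe_iff.1 (hq.trans_le (min_le_right _ _))⟩

namespace IsControlPenalty

/-- A function can only be unbounded on `[0, a)` if this interval is not empty. -/
lemma zero_mem (hη : IsControlPenalty a η) : (0 : ℝ) ∈ halfOpen a := by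
  obtain ⟨r, hr, -⟩ := hη.classKInf.unbounded 0
  exact mem_halfOpen_of_le hr le_rfl hr.1

lemma exists_dEta_eq (hη : IsControlPenalty a η) {b : ℝ} (hb : 0 ≤ b) :
    ∃ r ∈ halfOpen a, dEta a η r = b := by
  obtain ⟨r, hr, hbr⟩ := hη.classKInf_deriv.unbounded b
  have hsub : Icc 0 r ⊆ halfOpen a := fun q hq => mem_halfOpen_of_le hr hq.1 hq.2
  obtain ⟨q, hq, h⟩ := intermediate_value_Icc hr.1 (hη.classKInf_deriv.continuousOn.mono hsub)
    ⟨by rw [hη.classKInf_deriv.map_zero]; exact hb, hbr.le⟩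
  exact ⟨q, hsub hq, h⟩

lemma dEtaInv_mem (hη : IsControlPenalty a η) {b : ℝ} (hb : 0 ≤ b) :
    dEtaInv a η b ∈ halfOpen a :=
  Function.invFunOn_mem (hη.exists_dEta_eq hb)

lemma dEta_dEtaInv (hη : IsControlPenalty a η) {b : ℝ} (hb : 0 ≤ b) :
    dEta a η (dEtaInv a η b) = b :=
  Function.invFunOn_eq (hη.exists_dEta_eq hb)

lemma dEtaInv_lt_iff (hη : IsControlPenalty a η) {b r : ℝ} (hb : 0 ≤ b)
    (hr : r ∈ halfOpen a) : dEtaInv a η b < r ↔ b < dEta a η r := by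
  rw [← hη.classKInf_deriv.strictMonoOn.lt_iff_lt (hη.dEtaInv_mem hb) hr,
    hη.dEta_dEtaInv hb]

lemma lt_dEtaInv_iff (hη : IsControlPenalty a η) {b r : ℝ} (hb : 0 ≤ b)
    (hr : r ∈ halfOpen a) : r < dEtaInv a η b ↔ dEta a η r < b := by
  rw [← hη.classKInf_deriv.strictMonoOn.lt_iff_lt hr (hη.dEtaInv_mem hb),
    hη.dEta_dEtaInv hb]

lemma dEtaInv_zero (hη : IsControlPenalty a η) : dEtaInv a η 0 = 0 :=
  hη.classKInf_deriv.strictMonoOn.injOn (hη.dEtaInv_mem le_rfl) hη.zero_mem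
    (by rw [hη.dEta_dEtaInv le_rfl, hη.classKInf_deriv.map_zero])

lemma dEtaInv_pos (hη : IsControlPenalty a η) {b : ℝ} (hb : 0 < b) :
    0 < dEtaInv a η b := by
  rw [hη.lt_dEtaInv_iff hb.le hη.zero_mem, hη.classKInf_deriv.map_zero]
  exact hb

lemma continuousOn_dEtaInv (hη : IsControlPenalty a η) :
    ContinuousOn (dEtaInv a η) (Ici 0) := by
  intro b hb
  have hp := hη.dEtaInv_mem hb
  refine tendsto_order.2 ⟨fun l hl => ?_, fun u hu => ?_⟩
  · rcases lt_or_ge l 0 with hl0 | hl0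
    · filter_upwards [self_mem_nhdsWithin] with c hc
      exact hl0.trans_le (hη.dEtaInv_mem hc).1
    · have hlmem := mem_halfOpen_of_le hp hl0 hl.le
      rw [hη.lt_dEtaInv_iff hb hlmem] at hl
      filter_upwards [self_mem_nhdsWithin, mem_nhdsWithin_of_mem_nhds (lt_mem_nhds hl)]
        with c hc hlc
      exact (hη.lt_dEtaInv_iff hc hlmem).2 hlc
  · obtain ⟨q, hq, hpq, hqu⟩ := exists_gt_mem_halfOpen hp hu
    rw [hη.dEtaInv_lt_iff hb hq] at hpq
    filter_upwards [self_mem_nhdsWithin, mem_nhdsWithin_of_mem_nhds (gt_mem_nhds hpq)]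
      with c hc hcq
    exact ((hη.dEtaInv_lt_iff hc hq).2 hcq).trans hqu

lemma nonneg (hη : IsControlPenalty a η) {r : ℝ} (hr : r ∈ halfOpen a) : 0 ≤ η r := by
  rw [← hη.classKInf.map_zero]
  exact hη.classKInf.strictMonoOn.monotoneOn hη.zero_mem hr hr.1

lemma exists_dEta_eq_slope (hη : IsControlPenalty a η) {u v : ℝ} (hu : u ∈ halfOpen a)
    (hv : v ∈ halfOpen a) (huv : u < v) :
    ∃ c ∈ halfOpen a, u < c ∧ c < v ∧ η v - η u = dEta a η c * (v - u) := by
  have hsub : Icc u v ⊆ halfOpen a := fun q hq =>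
    mem_halfOpen_of_le hv (hu.1.trans hq.1) hq.2
  obtain ⟨c, hc, h⟩ := exists_hasDerivAt_eq_slope η (dEta a η) huv
    (hη.classKInf.continuousOn.mono hsub) fun c hc => by
      have hc' := hsub (Ioo_subset_Icc_self hc)
      refine (hη.differentiableOn c hc').hasDerivWithinAt.hasDerivAt ?_
      exact mem_of_superset (Icc_mem_nhds hc.1 hc.2) hsub
  refine ⟨c, hsub (Ioo_subset_Icc_self hc), hc.1, hc.2, ?_⟩
  rw [h, div_mul_cancel₀ _ (sub_pos.2 huv).ne']

/-- The graph of a control penalty lies above its tangent lines. -/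
lemma tangent_le (hη : IsControlPenalty a η) {p x : ℝ}
    (hp : p ∈ halfOpen a) (hx : x ∈ halfOpen a) : dEta a η p * (x - p) ≤ η x - η p := by
  have hmono := hη.classKInf_deriv.strictMonoOn.monotoneOn
  rcases lt_trichotomy x p with h | rfl | h
  · obtain ⟨c, hc, -, hcp, heq⟩ := hη.exists_dEta_eq_slope hx hp h
    nlinarith [hmono hc hp hcp.le]
  · simp
  · obtain ⟨c, hc, hpc, -, heq⟩ := hη.exists_dEta_eq_slope hp hx h
    nlinarith [hmono hp hc hpc.le]

/-- The Legendre–Fenchel transform in closed form. The right-hand side is the supremum over `x` of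
`x b - η x`, so `(η')⁻¹(b)` is a subgradient of it, and the integral of a continuous
subgradient recovers it. -/
lemma legendre_eq (hη : IsControlPenalty a η) {b : ℝ} (hb : 0 ≤ b) :
    legendre a η b = b * dEtaInv a η b - η (dEtaInv a η b) := by
  set L : ℝ → ℝ := fun b => b * dEtaInv a η b - η (dEtaInv a η b) with hL
  have hcont := hη.continuousOn_dEtaInv
  have hLcont : ContinuousOn L (Ici 0) := (continuousOn_id.mul hcont).sub
    (hη.classKInf.continuousOn.comp hcont fun c hc => hη.dEtaInv_mem hc)
  have hsub : ∀ {c d : ℝ}, 0 ≤ c → 0 ≤ d → dEtaInv a η c * (d - c) ≤ L d - L c := by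
    intro c d hc hd
    have := hη.tangent_le (hη.dEtaInv_mem hd) (hη.dEtaInv_mem hc)
    rw [hη.dEta_dEtaInv hd] at this
    simp only [hL]
    linarith
  have hIcc : Icc 0 b ⊆ Ici 0 := Icc_subset_Ici_self
  have hderiv : ∀ c ∈ Ioo 0 b, HasDerivWithinAt L (dEtaInv a η c) (Ioi c) c := by
    intro c hc
    rw [hasDerivWithinAt_iff_tendsto_slope' self_notMem_Ioi]
    refine tendsto_of_tendsto_of_tendsto_of_le_of_le' tendsto_const_nhds
      ((hcont c hc.1.le).mono (Ioi_subset_Ici_self.trans (Ici_subset_Ici.2 hc.1.le))) ?_ ?_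
    · filter_upwards [self_mem_nhdsWithin] with d hd
      rw [slope_def_field, le_div_iff₀ (sub_pos.2 hd)]
      exact hsub hc.1.le (hc.1.le.trans (le_of_lt hd))
    · filter_upwards [self_mem_nhdsWithin] with d hd
      rw [slope_def_field, div_le_iff₀ (sub_pos.2 hd)]
      linarith [hsub (hc.1.le.trans (le_of_lt hd)) hc.1.le]
  have h := intervalIntegral.integral_eq_sub_of_hasDeriv_right_of_le hb (hLcont.mono hIcc) hderiv
    ((hcont.mono hIcc).intervalIntegrable_of_Icc hb)
  rw [legendre, h]
  simp [hL, hη.dEtaInv_zero, hη.classKInf.map_zero]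

/-- The Fenchel–Young inequality. -/
lemma mul_le_add_legendre (hη : IsControlPenalty a η) {b x : ℝ} (hb : 0 ≤ b)
    (hx : x ∈ halfOpen a) : b * x ≤ η x + legendre a η b := by
  have := hη.tangent_le (hη.dEtaInv_mem hb) hx
  rw [hη.dEta_dEtaInv hb] at this
  rw [hη.legendre_eq hb]
  linarith

lemma legendre_zero : legendre a η 0 = 0 := intervalIntegral.integral_same

lemma legendre_nonneg (hη : IsControlPenalty a η) {b : ℝ} (hb : 0 ≤ b) :
    0 ≤ legendre a η b := by
  simpa [hη.classKInf.map_zero] using hη.mul_le_add_legendre hb hη.zero_mem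

lemma legendre_pos (hη : IsControlPenalty a η) {b : ℝ} (hb : 0 < b) :
    0 < legendre a η b := by
  have hb2 : 0 < b / 2 := half_pos hb
  have h1 := hη.mul_le_add_legendre hb.le (hη.dEtaInv_mem hb2.le)
  have h2 := hη.legendre_eq hb2.le
  have h3 := hη.legendre_nonneg hb2.le
  have h4 : 0 < b / 2 * dEtaInv a η (b / 2) := mul_pos hb2 (hη.dEtaInv_pos hb2)
  linarith

lemma legendre_le (hη : IsControlPenalty a η) {b : ℝ} (hb : 0 ≤ b) :
    legendre a η b ≤ b * dEtaInv a η b := by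
  rw [hη.legendre_eq hb]
  linarith [hη.nonneg (hη.dEtaInv_mem hb)]

lemma continuousOn_legendre (hη : IsControlPenalty a η) :
    ContinuousOn (legendre a η) (Ici 0) := by
  have hcont := hη.continuousOn_dEtaInv
  exact ((continuousOn_id.mul hcont).sub (hη.classKInf.continuousOn.comp hcont
    fun c hc => hη.dEtaInv_mem hc)).congr fun b hb => hη.legendre_eq hb

end IsControlPenalty

/-- The odd extension of a continuous function on `[0, ∞)` that vanishes at zero is continuous. -/
lemma continuous_oddExtension {f : ℝ → ℝ} (hf : ContinuousOn f (Ici 0)) (h0 : f 0 = 0) :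
    Continuous fun x => f |x| * Real.sign x := by
  have hfabs : Continuous fun x => f |x| :=
    hf.comp_continuous continuous_abs fun x => abs_nonneg x
  have h := hfabs.if_le hfabs.neg continuous_const continuous_id (f := fun _ => (0 : ℝ))
    fun x hx => by simp [show x = 0 from hx.symm, h0]
  refine h.congr fun x => ?_
  rcases lt_trichotomy x 0 with hx | rfl | hx
  · simp [hx.not_ge, Real.sign_of_neg hx]
  · simp [h0]
  · simp [hx.le, Real.sign_of_pos hx]

/-- The odd extension of `(η')⁻¹`. -/
def oddInv (a : EReal) (η : ℝ → ℝ) (x : ℝ) : ℝ := dEtaInv a η |x| * Real.sign x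

/-- The odd extension of `ℓη(r) / r`, which takes the value `0` at `0`. -/
def oddRatio (a : EReal) (η : ℝ → ℝ) (x : ℝ) : ℝ := legendre a η |x| / |x| * Real.sign x

lemma mul_sign_self (x : ℝ) : x * Real.sign x = |x| := by
  rcases lt_trichotomy x 0 with hx | rfl | hx
  · simp [abs_of_neg hx, Real.sign_of_neg hx]
  · simp
  · simp [abs_of_pos hx, Real.sign_of_pos hx]

lemma sign_pos_mul {ε : ℝ} (hε : 0 < ε) (x : ℝ) : Real.sign (ε * x) = Real.sign x := by
  rcases lt_trichotomy x 0 with hx | rfl | hx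
  · rw [Real.sign_of_neg hx, Real.sign_of_neg (mul_neg_of_pos_of_neg hε hx)]
  · simp
  · rw [Real.sign_of_pos hx, Real.sign_of_pos (mul_pos hε hx)]

lemma mul_oddInv (x : ℝ) : x * oddInv a η x = |x| * dEtaInv a η |x| := by
  rw [oddInv, mul_left_comm, mul_sign_self, mul_comm]

lemma mul_oddRatio (x : ℝ) : x * oddRatio a η x = legendre a η |x| := by
  rw [oddRatio, mul_left_comm, mul_sign_self]
  rcases eq_or_ne x 0 with rfl | hx
  · simp [IsControlPenalty.legendre_zero]
  · rw [div_mul_cancel₀ _ (abs_ne_zero.2 hx)]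

lemma abs_oddInv (hη : IsControlPenalty a η) (x : ℝ) :
    |oddInv a η x| = dEtaInv a η |x| := by
  have h0 := (hη.dEtaInv_mem (abs_nonneg x)).1
  rcases lt_trichotomy x 0 with hx | rfl | hx
  · simp [oddInv, Real.sign_of_neg hx, abs_of_nonneg h0]
  · simp [oddInv, hη.dEtaInv_zero]
  · simp [oddInv, Real.sign_of_pos hx, abs_of_nonneg h0]

lemma continuous_oddInv (hη : IsControlPenalty a η) : Continuous (oddInv a η) :=
  continuous_oddExtension (hη.continuousOn_dEtaInv) (hη.dEtaInv_zero)

lemma continuous_oddRatio (hη : IsControlPenalty a η) :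
    Continuous (oddRatio a η) := by
  refine continuous_oddExtension (f := fun r => legendre a η r / r) (fun r hr => ?_) (by simp)
  rcases (mem_Ici.1 hr).eq_or_lt with rfl | hr
  · -- Near zero the quotient lies between `0` and `(η')⁻¹(r)`.
    have h := hη.continuousOn_dEtaInv 0 self_mem_Ici
    rw [ContinuousWithinAt, hη.dEtaInv_zero] at h
    rw [ContinuousWithinAt, div_zero]
    refine tendsto_of_tendsto_of_tendsto_of_le_of_le' tendsto_const_nhds h ?_ ?_
    · filter_upwards [self_mem_nhdsWithin] with r hr
      exact div_nonneg (hη.legendre_nonneg hr) hr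
    · filter_upwards [self_mem_nhdsWithin] with r hr
      exact div_le_of_le_mul₀ hr (hη.dEtaInv_mem hr).1
        ((hη.legendre_le hr).trans_eq (mul_comm _ _))
  · exact (hη.continuousOn_legendre r hr.le).div continuousWithinAt_id hr.ne'

end Penalty

/-! ### Geometry of the state spaces -/

section StateSpace

lemma continuousOn_two_tan_half :
    ContinuousOn (fun x : ℝ => 2 * Real.tan (x / 2)) (Ioo (-Real.pi) Real.pi) := by
  refine continuousOn_const.mul (Real.continuousOn_tan_Ioo.comp
    (continuousOn_id.div_const 2) fun x hx => ?_)
  exact ⟨show -(Real.pi / 2) < x / 2 by linarith [hx.1],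
    show x / 2 < Real.pi / 2 by linarith [hx.2]⟩

lemma exists_isCompact_two_tan_half (R : ℝ) :
    ∃ C ⊆ Ioo (-Real.pi) Real.pi, IsCompact C ∧
      ∀ x ∈ Ioo (-Real.pi) Real.pi, |2 * Real.tan (x / 2)| ≤ R → x ∈ C := by
  have h1 := Real.arctan_lt_pi_div_two (R / 2)
  refine ⟨Icc (-(2 * Real.arctan (R / 2))) (2 * Real.arctan (R / 2)), fun x hx => ?_,
    isCompact_Icc, fun x hx hxR => ?_⟩
  · exact ⟨by linarith [hx.1], by linarith [hx.2]⟩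
  · have hx2 : Real.arctan (Real.tan (x / 2)) = x / 2 :=
      Real.arctan_tan (by linarith [hx.1]) (by linarith [hx.2])
    obtain ⟨hl, hu⟩ := abs_le.1 hxR
    have hu' := Real.arctan_mono (show Real.tan (x / 2) ≤ R / 2 by linarith)
    have hl' := Real.arctan_mono (show -(R / 2) ≤ Real.tan (x / 2) by linarith)
    rw [Real.arctan_neg] at hl'
    constructor <;> linarith

lemma exists_isCompact_id (R : ℝ) :
    ∃ C ⊆ (univ : Set ℝ), IsCompact C ∧ ∀ x ∈ (univ : Set ℝ), |x| ≤ R → x ∈ C :=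
  ⟨Icc (-R) R, subset_univ _, isCompact_Icc, fun _ _ hx => abs_le.1 hx⟩

namespace Space

variable (Q : Space)

lemma isOpen_deltaRange : IsOpen Q.deltaRange := by
  cases Q
  exacts [isOpen_univ, isOpen_univ, isOpen_Ioo, isOpen_Ioo]

lemma isOpen_gammaRange : IsOpen Q.gammaRange := by
  cases Q
  exacts [isOpen_univ, isOpen_Ioo, isOpen_univ, isOpen_Ioo]

lemma continuousOn_deltaCoord : ContinuousOn Q.deltaCoord Q.deltaRange := by
  cases Q
  exacts [continuousOn_id, continuousOn_id, continuousOn_two_tan_half, continuousOn_two_tan_half]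

lemma continuousOn_gammaCoord : ContinuousOn Q.gammaCoord Q.gammaRange := by
  cases Q
  exacts [continuousOn_id, continuousOn_two_tan_half, continuousOn_id, continuousOn_two_tan_half]

lemma exists_isCompact_delta (R : ℝ) :
    ∃ C ⊆ Q.deltaRange, IsCompact C ∧ ∀ x ∈ Q.deltaRange, |Q.deltaCoord x| ≤ R → x ∈ C := by
  cases Q
  exacts [exists_isCompact_id R, exists_isCompact_id R, exists_isCompact_two_tan_half R,
    exists_isCompact_two_tan_half R]

lemma exists_isCompact_gamma (R : ℝ) :
    ∃ C ⊆ Q.gammaRange, IsCompact C ∧ ∀ x ∈ Q.gammaRange, |Q.gammaCoord x| ≤ R → x ∈ C := by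
  cases Q
  exacts [exists_isCompact_id R, exists_isCompact_two_tan_half R, exists_isCompact_id R,
    exists_isCompact_two_tan_half R]

lemma isOpen_carrier : IsOpen Q.carrier :=
  isOpen_Ioi.prod (Q.isOpen_deltaRange.prod Q.isOpen_gammaRange)

lemma carrier_subset_extended : Q.carrier ⊆ Q.extended :=
  prod_mono Ioi_subset_Ici_self Subset.rfl

lemma mem_carrier_of_pos {Ξ : State} (h : Ξ ∈ Q.extended) (hρ : 0 < Ξ.1) : Ξ ∈ Q.carrier :=
  ⟨hρ, h.2⟩

lemma ne_zero_of_mem_carrier {Ξ : State} (h : Ξ ∈ Q.carrier) : Ξ ≠ 0 := by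
  rintro rfl
  exact lt_irrefl (0 : ℝ) h.1

lemma zero_mem_extended : (0 : State) ∈ Q.extended := by
  have hpi := Real.pi_pos
  refine ⟨self_mem_Ici, ?_⟩
  cases Q <;> simp [deltaRange, gammaRange, hpi]

lemma uniqueDiffOn_extended : UniqueDiffOn ℝ Q.extended :=
  (uniqueDiffOn_Ici 0).prod (Q.isOpen_deltaRange.prod Q.isOpen_gammaRange).uniqueDiffOn

lemma size_nonneg (Ξ : State) : 0 ≤ Q.size Ξ := Real.sqrt_nonneg _

lemma size_zero : Q.size 0 = 0 := by
  cases Q <;> simp [size, deltaCoord, gammaCoord]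

lemma continuousOn_size : ContinuousOn Q.size Q.extended := by
  have hδ : ContinuousOn (fun Ξ : State => Q.deltaCoord Ξ.2.1) Q.extended :=
    Q.continuousOn_deltaCoord.comp (by fun_prop) fun Ξ hΞ => hΞ.2.1
  have hγ : ContinuousOn (fun Ξ : State => Q.gammaCoord Ξ.2.2) Q.extended :=
    Q.continuousOn_gammaCoord.comp (by fun_prop) fun Ξ hΞ => hΞ.2.2
  exact (((continuousOn_fst.pow 2).add (hδ.pow 2)).add (hγ.pow 2)).sqrt

/-- The size is proper: it blows up at infinity and at the angular boundary. -/
lemma isCompact_size_le (R : ℝ) : IsCompact {Ξ ∈ Q.extended | Q.size Ξ ≤ R} := by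
  obtain ⟨C, hC, hCc, hCR⟩ := Q.exists_isCompact_delta R
  obtain ⟨D, hD, hDc, hDR⟩ := Q.exists_isCompact_gamma R
  have hsub : Icc 0 R ×ˢ (C ×ˢ D) ⊆ Q.extended := prod_mono Icc_subset_Ici_self (prod_mono hC hD)
  have hcomp : IsCompact (Icc 0 R ×ˢ (C ×ˢ D)) := isCompact_Icc.prod (hCc.prod hDc)
  have heq : {Ξ ∈ Q.extended | Q.size Ξ ≤ R}
      = (Icc 0 R ×ˢ (C ×ˢ D)) ∩ Q.size ⁻¹' Iic R := by
    ext Ξ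
    refine ⟨fun ⟨h, hR⟩ => ⟨⟨⟨h.1, (le_abs_self _).trans ?_⟩, hCR _ h.2.1 ?_, hDR _ h.2.2 ?_⟩, hR⟩,
      fun ⟨h, hR⟩ => ⟨hsub h, hR⟩⟩
    all_goals
      refine le_trans (Real.abs_le_sqrt ?_) hR
      nlinarith [sq_nonneg Ξ.1, sq_nonneg (Q.deltaCoord Ξ.2.1), sq_nonneg (Q.gammaCoord Ξ.2.2)]
  rw [heq]
  exact hcomp.of_isClosed_subset
    ((Q.continuousOn_size.mono hsub).preimage_isClosed_of_isClosed hcomp.isClosed isClosed_Iic)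
    inter_subset_left

end Space

end StateSpace

/-! ### Control Lyapunov functions and their sublevel sets -/

namespace IsStrictCLF

variable {Q : Space} {V : State → ℝ}

lemma map_zero (hV : IsStrictCLF Q V) : V 0 = 0 := by
  obtain ⟨α₁, α₂, h₁, h₂, h⟩ := hV.bounds
  have := h 0 Q.zero_mem_extended
  rw [Q.size_zero, h₁.map_zero, h₂.map_zero] at this
  exact le_antisymm this.2 this.1

lemma nonneg (hV : IsStrictCLF Q V) {Ξ : State} (hΞ : Ξ ∈ Q.extended) : 0 ≤ V Ξ := by
  obtain ⟨α₁, α₂, h₁, h₂, h⟩ := hV.bounds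
  refine le_trans ?_ (h Ξ hΞ).1
  rw [← h₁.map_zero]
  exact h₁.strictMonoOn.monotoneOn (mem_halfOpen_top.2 le_rfl)
    (mem_halfOpen_top.2 (Q.size_nonneg Ξ)) (Q.size_nonneg Ξ)

lemma isCompact_sublevel (hV : IsStrictCLF Q V) (c : ℝ) :
    IsCompact {Ξ ∈ Q.extended | V Ξ ≤ c} := by
  obtain ⟨α₁, α₂, h₁, h₂, h⟩ := hV.bounds
  obtain ⟨R, hR, hcR⟩ := h₁.unbounded c
  have hK := Q.isCompact_size_le R
  have heq : {Ξ ∈ Q.extended | V Ξ ≤ c}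
      = {Ξ ∈ Q.extended | Q.size Ξ ≤ R} ∩ V ⁻¹' Iic c := by
    ext Ξ
    refine ⟨fun ⟨hΞ, hc⟩ => ⟨⟨hΞ, ?_⟩, hc⟩, fun ⟨hΞ, hc⟩ => ⟨hΞ.1, hc⟩⟩
    refine (h₁.strictMonoOn.lt_iff_lt (mem_halfOpen_top.2 (Q.size_nonneg Ξ)) hR).1 ?_ |>.le
    exact ((h Ξ hΞ).1.trans hc).trans_lt hcR
  rw [heq]
  exact hK.of_isClosed_subset ((hV.contDiffOn.continuousOn.mono
    fun Ξ hΞ => hΞ.1).preimage_isClosed_of_isClosed hK.isClosed isClosed_Iic) inter_subset_left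

lemma isOpen_strict_sublevel (hV : IsStrictCLF Q V) (c : ℝ) :
    IsOpen {Ξ ∈ Q.carrier | V Ξ < c} :=
  (hV.contDiffOn.continuousOn.mono Q.carrier_subset_extended).isOpen_inter_preimage
    Q.isOpen_carrier isOpen_Iio

lemma continuousOn_lieDeriv (hV : IsStrictCLF Q V) {g : State → State} (hg : Continuous g) :
    ContinuousOn (lieDeriv Q V g) Q.extended :=
  (hV.contDiffOn.continuousOn_fderivWithin Q.uniqueDiffOn_extended le_rfl).clm_apply
    hg.continuousOn

lemma hasFDerivAt (hV : IsStrictCLF Q V) {Ξ : State} (hΞ : Ξ ∈ Q.carrier) :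
    HasFDerivAt V (fderivWithin ℝ V Q.extended Ξ) Ξ :=
  (hV.contDiffOn.differentiableOn one_ne_zero Ξ
    (Q.carrier_subset_extended hΞ)).hasFDerivWithinAt.hasFDerivAt
    (mem_of_superset (Q.isOpen_carrier.mem_nhds hΞ) Q.carrier_subset_extended)

end IsStrictCLF

lemma continuous_g1 : Continuous g1 := by unfold g1; fun_prop

lemma continuous_g2 : Continuous g2 := continuous_const

/-! ### Feedback laws under which the control Lyapunov function decreases -/

/-- The derivative of `V` along the vector field `u₁ ḡ₁ + u₂ g₂`. -/
def descentRate (Q : Space) (V u₁ u₂ : State → ℝ) (Ξ : State) : ℝ :=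
  lieDeriv Q V g1 Ξ * u₁ Ξ + lieDeriv Q V g2 Ξ * u₂ Ξ

/-- The closed-loop vector field `u₁ ḡ₁ + u₂ g₂`, which is meaningful also for `ρ = 0`. -/
def loopField (u₁ u₂ : State → ℝ) (Ξ : State) : State := u₁ Ξ • g1 Ξ + u₂ Ξ • g2 Ξ

/-- The feedback law `k` is `(ρ u₁, u₂)`, where `u₁` and `u₂` are continuous up to `ρ = 0` and
make `V` strictly decrease away from the target. -/
structure IsDescentFeedback (Q : Space) (V : State → ℝ) (k : State → ℝ × ℝ)
    (u₁ u₂ : State → ℝ) : Prop where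
  continuousOn_fst : ContinuousOn u₁ Q.extended
  continuousOn_snd : ContinuousOn u₂ Q.extended
  eq_on : ∀ Ξ ∈ Q.extended, k Ξ = (Ξ.1 * u₁ Ξ, u₂ Ξ)
  descentRate_neg : ∀ Ξ ∈ Q.extended, Ξ ≠ 0 → descentRate Q V u₁ u₂ Ξ < 0

/-- `X` is continuous on `[s, t]`, stays in `𝒬`, and solves `X' = u₁ ḡ₁ + u₂ g₂` in the sense of
right derivatives. -/
structure IsRightSolution (Q : Space) (u₁ u₂ : State → ℝ) (X : ℝ → State) (s t : ℝ) : Prop where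
  continuousOn : ContinuousOn X (Icc s t)
  mem : ∀ r ∈ Icc s t, X r ∈ Q.carrier
  hasDeriv : ∀ r ∈ Ico s t, HasDerivWithinAt X (loopField u₁ u₂ (X r)) (Ici r) r

section Descent

variable {Q : Space} {V : State → ℝ} {k : State → ℝ × ℝ} {u₁ u₂ : State → ℝ}

lemma fderivWithin_loopField (Ξ : State) :
    fderivWithin ℝ V Q.extended Ξ (loopField u₁ u₂ Ξ) = descentRate Q V u₁ u₂ Ξ := by
  simp only [loopField, descentRate, lieDeriv, map_add, map_smul, smul_eq_mul]
  ring

namespace IsRightSolution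

variable {X : ℝ → State} {s t : ℝ}

lemma mono (hX : IsRightSolution Q u₁ u₂ X s t) {s' t' : ℝ} (hs : s ≤ s') (ht : t' ≤ t) :
    IsRightSolution Q u₁ u₂ X s' t' :=
  ⟨hX.continuousOn.mono (Icc_subset_Icc hs ht), fun r hr => hX.mem r (Icc_subset_Icc hs ht hr),
    fun r hr => hX.hasDeriv r (Ico_subset_Ico hs ht hr)⟩

lemma hasDeriv_comp (hV : IsStrictCLF Q V) (hX : IsRightSolution Q u₁ u₂ X s t) {r : ℝ}
    (hr : r ∈ Ico s t) :
    HasDerivWithinAt (fun r => V (X r)) (descentRate Q V u₁ u₂ (X r)) (Ici r) r := by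
  rw [← fderivWithin_loopField]
  exact (hV.hasFDerivAt (hX.mem r (Ico_subset_Icc_self hr))).comp_hasDerivWithinAt r
    (hX.hasDeriv r hr)

lemma continuousOn_comp (hV : IsStrictCLF Q V) (hX : IsRightSolution Q u₁ u₂ X s t) :
    ContinuousOn (fun r => V (X r)) (Icc s t) :=
  hV.contDiffOn.continuousOn.comp hX.continuousOn
    fun r hr => Q.carrier_subset_extended (hX.mem r hr)

lemma le_sub_mul (hV : IsStrictCLF Q V) (hX : IsRightSolution Q u₁ u₂ X s t) (hst : s ≤ t) {m : ℝ}
    (hm : ∀ r ∈ Ico s t, descentRate Q V u₁ u₂ (X r) ≤ -m) :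
    V (X t) ≤ V (X s) - m * (t - s) := by
  refine image_le_of_deriv_right_le_deriv_boundary (hX.continuousOn_comp hV)
    (fun r hr => hX.hasDeriv_comp hV hr) (B := fun r => V (X s) - m * (r - s))
    (B' := fun _ => -m) (by simp) (by fun_prop) (fun r _ => ?_) hm (right_mem_Icc.2 hst)
  have := (((hasDerivAt_id r).sub_const s).const_mul m).const_sub (V (X s))
  simpa using this.hasDerivWithinAt

lemma le_of_le (hV : IsStrictCLF Q V) (hk : IsDescentFeedback Q V k u₁ u₂)
    (hX : IsRightSolution Q u₁ u₂ X s t) (hst : s ≤ t) : V (X t) ≤ V (X s) := by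
  have := hX.le_sub_mul hV hst (m := 0) fun r hr => by
    have hr' := hX.mem r (Ico_subset_Icc_self hr)
    simpa using (hk.descentRate_neg _ (Q.carrier_subset_extended hr')
      (Q.ne_zero_of_mem_carrier hr')).le
  simpa using this

/-- The distance `ρ` decays at most exponentially, so it stays positive in finite time. -/
lemma rho_mul_exp_le (hX : IsRightSolution Q u₁ u₂ X s t) (hst : s ≤ t) {M : ℝ}
    (hM : ∀ r ∈ Ico s t, |u₁ (X r)| ≤ M) :
    (X s).1 * Real.exp (M * s) ≤ (X t).1 * Real.exp (M * t) := by
  have hcont : ContinuousOn (fun r => (X r).1 * Real.exp (M * r)) (Icc s t) :=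
    (continuous_fst.comp_continuousOn hX.continuousOn).mul (by fun_prop)
  refine image_le_of_deriv_right_le_deriv_boundary
    (f := fun _ => (X s).1 * Real.exp (M * s)) (f' := fun _ => 0) continuousOn_const
    (fun r _ => hasDerivWithinAt_const _ _ _) (B := fun r => (X r).1 * Real.exp (M * r))
    (B' := fun r => (loopField u₁ u₂ (X r)).1 * Real.exp (M * r)
      + (X r).1 * (Real.exp (M * r) * M)) le_rfl hcont (fun r hr => ?_) (fun r hr => ?_)
    (right_mem_Icc.2 hst)
  · have h1 : HasDerivWithinAt (fun r => (X r).1) (loopField u₁ u₂ (X r)).1 (Ici r) r :=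
      (hX.hasDeriv r hr).fst
    have h2 : HasDerivAt (fun r => Real.exp (M * r)) (Real.exp (M * r) * M) r := by
      simpa using ((hasDerivAt_id r).const_mul M).exp
    exact h1.mul h2.hasDerivWithinAt
  · have hρ : 0 < (X r).1 := (hX.mem r (Ico_subset_Icc_self hr)).1
    have hcos : u₁ (X r) * Real.cos (X r).2.2 ≤ M := by
      refine (le_abs_self _).trans ?_
      rw [abs_mul]
      exact (mul_le_of_le_one_right (abs_nonneg _) (Real.abs_cos_le_one _)).trans (hM r hr)
    have : (loopField u₁ u₂ (X r)).1 = -(u₁ (X r) * Real.cos (X r).2.2) * (X r).1 := by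
      simp [loopField, g1, g2]
      ring
    rw [this]
    have h3 : 0 ≤ (M - u₁ (X r) * Real.cos (X r).2.2) * ((X r).1 * Real.exp (M * r)) :=
      mul_nonneg (sub_nonneg.2 hcos) (by positivity)
    linarith

end IsRightSolution

lemma IsDescentFeedback.continuousOn_loopField (hk : IsDescentFeedback Q V k u₁ u₂) :
    ContinuousOn (loopField u₁ u₂) Q.extended :=
  (hk.continuousOn_fst.smul continuous_g1.continuousOn).add
    (hk.continuousOn_snd.smul continuous_g2.continuousOn)

lemma IsDescentFeedback.continuousOn_descentRate (hV : IsStrictCLF Q V)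
    (hk : IsDescentFeedback Q V k u₁ u₂) : ContinuousOn (descentRate Q V u₁ u₂) Q.extended :=
  ((hV.continuousOn_lieDeriv continuous_g1).mul hk.continuousOn_fst).add
    ((hV.continuousOn_lieDeriv continuous_g2).mul hk.continuousOn_snd)

lemma IsDescentFeedback.field_eq (hk : IsDescentFeedback Q V k u₁ u₂) {Ξ : State}
    (hΞ : Ξ ∈ Q.carrier) : field Ξ (k Ξ).1 (k Ξ).2 = loopField u₁ u₂ Ξ := by
  have hρ : Ξ.1 ≠ 0 := ne_of_gt hΞ.1
  rw [hk.eq_on Ξ (Q.carrier_subset_extended hΞ), field, loopField, mul_div_cancel_left₀ _ hρ]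

/-- On the part of a bounded sublevel set away from the target, `V` decreases at a uniform rate. -/
lemma IsDescentFeedback.exists_descentRate_le (hV : IsStrictCLF Q V)
    (hk : IsDescentFeedback Q V k u₁ u₂) {c C : ℝ} (hc : 0 < c) :
    ∃ m > 0, ∀ Ξ ∈ Q.extended, c ≤ V Ξ → V Ξ ≤ C → descentRate Q V u₁ u₂ Ξ ≤ -m := by
  have hcomp : IsCompact ({Ξ ∈ Q.extended | V Ξ ≤ C} ∩ V ⁻¹' Ici c) :=
    (hV.isCompact_sublevel C).of_isClosed_subset ((hV.contDiffOn.continuousOn.mono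
      fun Ξ hΞ => hΞ.1).preimage_isClosed_of_isClosed (hV.isCompact_sublevel C).isClosed
        isClosed_Ici) inter_subset_left
  rcases ({Ξ ∈ Q.extended | V Ξ ≤ C} ∩ V ⁻¹' Ici c).eq_empty_or_nonempty with hemp | hne
  · refine ⟨1, one_pos, fun Ξ hΞ h1 h2 => ?_⟩
    exact (Set.notMem_empty Ξ (hemp ▸ ⟨⟨hΞ, h2⟩, h1⟩)).elim
  · obtain ⟨Ξ₀, hΞ₀, hmax⟩ := hcomp.exists_isMaxOn hne
      ((hk.continuousOn_descentRate hV).mono fun Ξ hΞ => hΞ.1.1)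
    have hne0 : Ξ₀ ≠ 0 := by
      rintro rfl
      have h0 : c ≤ V 0 := hΞ₀.2
      rw [hV.map_zero] at h0
      exact hc.not_ge h0
    refine ⟨-descentRate Q V u₁ u₂ Ξ₀, neg_pos.2 (hk.descentRate_neg _ hΞ₀.1.1 hne0),
      fun Ξ hΞ h1 h2 => ?_⟩
    rw [neg_neg]
    exact hmax ⟨⟨hΞ, h2⟩, h1⟩

/-! ### Closed-loop trajectories as solutions with right derivatives -/

lemma measurableSet_halfOpen (T : EReal) : MeasurableSet (halfOpen T) := by
  refine Set.OrdConnected.measurableSet ⟨fun x hx y hy z hz => ?_⟩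
  exact mem_halfOpen_of_le hy (hx.1.trans hz.1) hz.2

lemma IsTrajectory.continuousOn {T : EReal} {X : ℝ → State} {v ω : ℝ → ℝ}
    (hX : IsTrajectory Q T X v ω) : ContinuousOn X (halfOpen T) := by
  intro t ht
  obtain ⟨q, hq, htq, -⟩ := exists_gt_mem_halfOpen ht (lt_add_one t)
  have h1 := intervalIntegral.continuousOn_primitive_interval' (hX.integrable q hq) left_mem_uIcc
  rw [uIcc_of_le hq.1] at h1
  have h2 : ContinuousOn X (Icc 0 q) := (continuousOn_const.add h1).congr fun r hr =>
    hX.eq_integral r (mem_halfOpen_of_le hq hr.1 hr.2)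
  refine (h2 t ⟨ht.1, htq.le⟩).mono_of_mem_nhdsWithin ?_
  filter_upwards [self_mem_nhdsWithin, mem_nhdsWithin_of_mem_nhds (gt_mem_nhds htq)] with r hr hrq
  exact ⟨hr.1, hrq.le⟩

lemma hasDerivWithinAt_primitive {X F : ℝ → State} {q : ℝ} (hF : ContinuousOn F (Icc 0 q))
    (hX : ∀ t ∈ Icc 0 q, X t = X 0 + ∫ s in (0 : ℝ)..t, F s) {t : ℝ} (ht : t ∈ Ico 0 q) :
    HasDerivWithinAt X (F t) (Ici t) t := by
  have hsub : Icc 0 t ⊆ Icc 0 q := Icc_subset_Icc_right ht.2.le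
  have hint : IntervalIntegrable F volume 0 t :=
    (hF.mono hsub).intervalIntegrable_of_Icc ht.1
  have hsub' : Ioo t q ⊆ Icc 0 q := fun r hr => ⟨ht.1.trans hr.1.le, hr.2.le⟩
  have hmeas : StronglyMeasurableAtFilter F (𝓝[>] t) := by
    rw [← nhdsWithin_Ioo_eq_nhdsGT ht.2]
    exact (hF.mono hsub').stronglyMeasurableAtFilter_nhdsWithin measurableSet_Ioo t
  have hcont : ContinuousWithinAt F (Ioi t) t := by
    have := (hF t ⟨ht.1, ht.2.le⟩).mono hsub'
    rwa [ContinuousWithinAt, nhdsWithin_Ioo_eq_nhdsGT ht.2] at this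
  have h1 := (intervalIntegral.integral_hasDerivWithinAt_right hint (s := Ici t) (t := Ioi t)
    hmeas hcont).const_add (X 0)
  refine h1.congr_of_eventuallyEq ?_ (hX t ⟨ht.1, ht.2.le⟩)
  filter_upwards [Ico_mem_nhdsGE ht.2] with r hr
  exact hX r ⟨ht.1.trans hr.1, hr.2.le⟩

namespace IsDescentFeedback

lemma isRightSolution_of_isClosedLoop (hk : IsDescentFeedback Q V k u₁ u₂) {T : EReal}
    {X : ℝ → State} (hX : IsClosedLoop Q k T X) {q : ℝ} (hq : q ∈ halfOpen T) :
    IsRightSolution Q u₁ u₂ X 0 q := by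
  have hsub : Icc 0 q ⊆ halfOpen T := fun r hr => mem_halfOpen_of_le hq hr.1 hr.2
  have hcont : ContinuousOn X (Icc 0 q) := (IsTrajectory.continuousOn hX).mono hsub
  have hF : ContinuousOn (fun t => loopField u₁ u₂ (X t)) (Icc 0 q) :=
    hk.continuousOn_loopField.comp hcont
      fun r hr => Q.carrier_subset_extended (hX.mem r (hsub hr))
  refine ⟨hcont, fun r hr => hX.mem r (hsub hr), fun r hr =>
    hasDerivWithinAt_primitive hF (fun t ht => ?_) hr⟩
  rw [hX.eq_integral t (hsub ht)]
  congr 1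
  refine intervalIntegral.integral_congr fun s hs => ?_
  rw [uIcc_of_le ht.1] at hs
  exact hk.field_eq (hX.mem s (hsub ⟨hs.1, hs.2.trans ht.2⟩))

lemma isClosedLoop_of_isRightSolution (hk : IsDescentFeedback Q V k u₁ u₂) {T : EReal}
    {X : ℝ → State} (hX : ∀ q ∈ halfOpen T, IsRightSolution Q u₁ u₂ X 0 q) :
    IsClosedLoop Q k T X := by
  have hmem : ∀ t ∈ halfOpen T, X t ∈ Q.carrier := fun t ht =>
    (hX t ht).mem t (right_mem_Icc.2 ht.1)
  have hext : MapsTo X (halfOpen T) Q.extended := fun t ht =>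
    Q.carrier_subset_extended (hmem t ht)
  have hcont : ContinuousOn X (halfOpen T) := by
    intro t ht
    obtain ⟨q, hq, htq, -⟩ := exists_gt_mem_halfOpen ht (lt_add_one t)
    refine ((hX q hq).continuousOn t ⟨ht.1, htq.le⟩).mono_of_mem_nhdsWithin ?_
    filter_upwards [self_mem_nhdsWithin, mem_nhdsWithin_of_mem_nhds (gt_mem_nhds htq)]
      with r hr hrq
    exact ⟨hr.1, hrq.le⟩
  have hF : ContinuousOn (fun t => loopField u₁ u₂ (X t)) (halfOpen T) :=
    hk.continuousOn_loopField.comp hcont hext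
  have hFint : ∀ t ∈ halfOpen T,
      IntervalIntegrable (fun t => loopField u₁ u₂ (X t)) volume 0 t := fun t ht =>
    (hF.mono fun r hr => mem_halfOpen_of_le ht hr.1 hr.2).intervalIntegrable_of_Icc ht.1
  have hfield : ∀ t ∈ halfOpen T, EqOn (fun s => field (X s) (k (X s)).1 (k (X s)).2)
      (fun s => loopField u₁ u₂ (X s)) (uIcc 0 t) := fun t ht s hs => by
    rw [uIcc_of_le ht.1] at hs
    exact hk.field_eq (hmem s (mem_halfOpen_of_le ht hs.1 hs.2))
  have h1 : ContinuousOn (fun t => (k (X t)).1) (halfOpen T) :=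
    ((continuous_fst.comp_continuousOn hcont).mul (hk.continuousOn_fst.comp hcont hext)).congr
      fun t ht => by rw [hk.eq_on _ (hext ht)]; rfl
  have h2 : ContinuousOn (fun t => (k (X t)).2) (halfOpen T) :=
    (hk.continuousOn_snd.comp hcont hext).congr fun t ht => by rw [hk.eq_on _ (hext ht)]; rfl
  refine ⟨h1.aemeasurable (measurableSet_halfOpen T), h2.aemeasurable (measurableSet_halfOpen T),
    hmem, fun t ht => ?_, fun t ht => ?_⟩
  · exact (hFint t ht).congr (fun s hs => (hfield t ht (uIoc_subset_uIcc hs)).symm)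
  · rw [intervalIntegral.integral_congr (hfield t ht),
      intervalIntegral.integral_eq_sub_of_hasDeriv_right_of_le ht.1 (hX t ht).continuousOn
        (fun r hr => ((hX t ht).hasDeriv r (Ioo_subset_Ico_self hr)).mono Ioi_subset_Ici_self)
        (hFint t ht)]
    abel

end IsDescentFeedback

end Descent

/-! ### Forward completeness and asymptotic stability -/

section Completeness

variable {Q : Space} {V : State → ℝ} {k : State → ℝ × ℝ} {u₁ u₂ : State → ℝ}

/-- A continuous vector field on a compact set extends to a bounded continuous one. -/
lemma exists_bounded_extension {K : Set State} (hK : IsCompact K) {F : State → State}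
    (hF : ContinuousOn F K) :
    ∃ (G : State → State) (M : ℝ), Continuous G ∧ (∀ x, ‖G x‖ ≤ M) ∧ EqOn G F K := by
  have : CompactSpace K := isCompact_iff_compactSpace.1 hK
  obtain ⟨g, -, hg⟩ := BoundedContinuousFunction.exists_norm_eq_domRestrict_eq hK.isClosed ℝ
    (BoundedContinuousFunction.mkOfCompact ⟨K.domRestrict F, hF.domRestrict⟩)
  refine ⟨g, ‖g‖, g.continuous, g.norm_coe_le_norm, fun x hx => ?_⟩
  exact DFunLike.congr_fun hg ⟨x, hx⟩

/-- From every state in `𝒬` there is a solution for all times. The vector field is extended from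
a compact sublevel set of `V` to a bounded continuous one; a solution of the extended equation
cannot leave the smaller sublevel set in which it starts, and keeps `ρ > 0`. -/
lemma IsDescentFeedback.exists_isRightSolution (hV : IsStrictCLF Q V)
    (hk : IsDescentFeedback Q V k u₁ u₂) {Ξ₀ : State} (hΞ₀ : Ξ₀ ∈ Q.carrier) :
    ∃ X : ℝ → State, X 0 = Ξ₀ ∧ ∀ t, 0 ≤ t → IsRightSolution Q u₁ u₂ X 0 t := by
  set c := V Ξ₀ with hc
  set K : Set State := {Ξ ∈ Q.extended | V Ξ ≤ c + 1} with hKdef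
  have hK : IsCompact K := hV.isCompact_sublevel (c + 1)
  obtain ⟨G, B, hG, hB, hGF⟩ := exists_bounded_extension hK
    (hk.continuousOn_loopField.mono fun Ξ hΞ => hΞ.1)
  obtain ⟨M, hM⟩ := hK.exists_bound_of_continuousOn
    (hk.continuousOn_fst.mono fun Ξ hΞ => hΞ.1)
  obtain ⟨X, hXc, hX⟩ := exists_solution_of_continuous hG hB Ξ₀
  have hX0 : X 0 = Ξ₀ := by simpa using hX 0 le_rfl
  have hderiv : ∀ t, 0 ≤ t → HasDerivWithinAt X (G (X t)) (Ici t) t := fun t ht =>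
    hasDerivWithinAt_primitive (q := t + 1) (hG.comp hXc).continuousOn
      (fun r hr => by rw [hX0]; exact hX r hr.1) ⟨ht, lt_add_one t⟩
  set S : Set ℝ := X ⁻¹' {Ξ ∈ Q.extended | V Ξ ≤ c} ∩ {t | Ξ₀.1 ≤ (X t).1 * Real.exp (M * t)}
    with hS
  have hSclosed : IsClosed S := ((hV.isCompact_sublevel c).isClosed.preimage hXc).inter
    (isClosed_le continuous_const ((continuous_fst.comp hXc).mul (by fun_prop)))
  have hScarrier : ∀ t ∈ S, X t ∈ Q.carrier := fun t ht =>
    Q.mem_carrier_of_pos ht.1.1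
      (pos_of_mul_pos_left (lt_of_lt_of_le hΞ₀.1 ht.2) (Real.exp_pos _).le)
  have h0 : (0 : ℝ) ∈ S := by
    refine ⟨?_, ?_⟩
    · change X 0 ∈ Q.extended ∧ V (X 0) ≤ c
      rw [hX0]
      exact ⟨Q.carrier_subset_extended hΞ₀, le_rfl⟩
    · simp [hX0]
  have hstep : ∀ T, 0 ≤ T → Icc 0 T ⊆ S := by
    intro T hT
    refine IsClosed.Icc_subset_of_forall_exists_gt (hSclosed.inter isClosed_Icc) h0 ?_
    intro t ht y hy
    -- Until a slightly later time the solution stays in the open set `V < c + 1` of `𝒬`, where the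
    -- extended field is the closed-loop field.
    have hO := hV.isOpen_strict_sublevel (c + 1)
    have hnear : X ⁻¹' {Ξ ∈ Q.carrier | V Ξ < c + 1} ∈ 𝓝[≥] t := by
      refine mem_nhdsWithin_of_mem_nhds ((hO.preimage hXc).mem_nhds ?_)
      exact ⟨hScarrier t ht.1, lt_of_le_of_lt ht.1.1.2 (lt_add_one c)⟩
    obtain ⟨q, hq, hqsub⟩ := mem_nhdsGE_iff_exists_Icc_subset.1 hnear
    have hr1 : t < min q y := lt_min hq hy
    have hloc : ∀ r ∈ Icc t (min q y), X r ∈ Q.carrier ∧ V (X r) < c + 1 := fun r hr =>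
      hqsub ⟨hr.1, hr.2.trans (min_le_left _ _)⟩
    have hlocK : ∀ r ∈ Icc t (min q y), X r ∈ K := fun r hr =>
      ⟨Q.carrier_subset_extended (hloc r hr).1, (hloc r hr).2.le⟩
    have hsol : IsRightSolution Q u₁ u₂ X t (min q y) :=
      ⟨hXc.continuousOn, fun r hr => (hloc r hr).1, fun r hr => by
        rw [← hGF (hlocK r (Ico_subset_Icc_self hr))]
        exact hderiv r (ht.2.1.trans hr.1)⟩
    refine ⟨min q y, ⟨⟨?_, ?_⟩, hr1, min_le_right _ _⟩⟩
    · exact ⟨Q.carrier_subset_extended (hloc _ (right_mem_Icc.2 hr1.le)).1,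
        (hsol.le_of_le hV hk hr1.le).trans ht.1.1.2⟩
    · exact le_trans ht.1.2 (hsol.rho_mul_exp_le hr1.le fun r hr =>
        hM _ (hlocK r (Ico_subset_Icc_self hr)))
  refine ⟨X, hX0, fun T hT => ⟨hXc.continuousOn, fun t ht => hScarrier t (hstep T hT ht),
    fun t ht => ?_⟩⟩
  have hmem := hstep T hT (Ico_subset_Icc_self ht)
  rw [← hGF (show X t ∈ K from ⟨hmem.1.1, hmem.1.2.trans (lt_add_one c).le⟩)]
  exact hderiv t ht.1

/-- A solution on a bounded interval `[0, T)` has a limit in `𝒬` at `T`. -/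
lemma IsDescentFeedback.exists_isRightSolution_closure (hV : IsStrictCLF Q V)
    (hk : IsDescentFeedback Q V k u₁ u₂) {T : ℝ} (hT : 0 < T) {X : ℝ → State}
    (hX : ∀ t ∈ Ico 0 T, IsRightSolution Q u₁ u₂ X 0 t) :
    ∃ Y : ℝ → State, IsRightSolution Q u₁ u₂ Y 0 T ∧ EqOn X Y (Ico 0 T) := by
  have h0 : (0 : ℝ) ∈ Ico 0 T := ⟨le_rfl, hT⟩
  have hself : ∀ t ∈ Ico 0 T, X t ∈ Q.carrier := fun t ht =>
    (hX t ht).mem t (right_mem_Icc.2 ht.1)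
  set K : Set State := {Ξ ∈ Q.extended | V Ξ ≤ V (X 0)} with hKdef
  have hK : IsCompact K := hV.isCompact_sublevel _
  have hXK : ∀ t ∈ Ico 0 T, X t ∈ K := fun t ht =>
    ⟨Q.carrier_subset_extended (hself t ht), (hX t ht).le_of_le hV hk ht.1⟩
  obtain ⟨M, hM⟩ := hK.exists_bound_of_continuousOn
    (hk.continuousOn_fst.mono fun Ξ hΞ => hΞ.1)
  obtain ⟨B, hB⟩ := hK.exists_bound_of_continuousOn
    (hk.continuousOn_loopField.mono fun Ξ hΞ => hΞ.1)
  have hcont : ContinuousOn X (Ico 0 T) := by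
    intro t ht
    obtain ⟨q, htq, hqT⟩ := exists_between ht.2
    refine ((hX q ⟨ht.1.trans htq.le, hqT⟩).continuousOn t ⟨ht.1, htq.le⟩).mono_of_mem_nhdsWithin ?_
    filter_upwards [self_mem_nhdsWithin, mem_nhdsWithin_of_mem_nhds (gt_mem_nhds htq)]
      with r hr hrq
    exact ⟨hr.1, hrq.le⟩
  set F : ℝ → State := fun t => loopField u₁ u₂ (X t) with hFdef
  have hF : ContinuousOn F (Ico 0 T) :=
    hk.continuousOn_loopField.comp hcont fun t ht => (hXK t ht).1
  have hFint : IntervalIntegrable F volume 0 T := by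
    rw [intervalIntegrable_iff_integrableOn_Ico_of_le hT.le]
    refine ⟨hF.aestronglyMeasurable measurableSet_Ico,
      .restrict_of_bounded (C := B) measure_Ico_lt_top ?_⟩
    filter_upwards [self_mem_ae_restrict measurableSet_Ico] with t ht using hB _ (hXK t ht)
  set Y : ℝ → State := fun t => X 0 + ∫ s in (0 : ℝ)..t, F s with hY
  have hYcont : ContinuousOn Y (Icc 0 T) := by
    have h1 := intervalIntegral.continuousOn_primitive_interval' hFint left_mem_uIcc
    rw [uIcc_of_le hT.le] at h1
    exact continuousOn_const.add h1
  have hXY : EqOn X Y (Ico 0 T) := by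
    intro t ht
    simp only [hY]
    rw [intervalIntegral.integral_eq_sub_of_hasDeriv_right_of_le ht.1 (hX t ht).continuousOn
        (fun r hr => ((hX t ht).hasDeriv r (Ioo_subset_Ico_self hr)).mono Ioi_subset_Ici_self)
        ((hF.mono fun r hr => ⟨hr.1, hr.2.trans_lt ht.2⟩).intervalIntegrable_of_Icc ht.1)]
    abel
  have hYT : Tendsto Y (𝓝[Ico 0 T] T) (𝓝 (Y T)) :=
    (hYcont T (right_mem_Icc.2 hT.le)).mono Ico_subset_Icc_self
  have : (𝓝[Ico 0 T] T).NeBot := by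
    rw [← mem_closure_iff_nhdsWithin_neBot, closure_Ico hT.ne]
    exact right_mem_Icc.2 hT.le
  have hYTK : Y T ∈ K := by
    refine hK.isClosed.mem_of_tendsto hYT ?_
    filter_upwards [self_mem_nhdsWithin] with t ht
    rw [← hXY ht]
    exact hXK t ht
  have hρ : (X 0).1 ≤ (Y T).1 * Real.exp (M * T) := by
    have hlim : Tendsto (fun t => (Y t).1 * Real.exp (M * t)) (𝓝[Ico 0 T] T)
        (𝓝 ((Y T).1 * Real.exp (M * T))) :=
      ((continuous_fst.tendsto _).comp hYT).mul
        ((show Continuous fun t => Real.exp (M * t) by fun_prop).tendsto T |>.mono_left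
          nhdsWithin_le_nhds)
    refine ge_of_tendsto hlim ?_
    filter_upwards [self_mem_nhdsWithin] with t ht
    rw [← hXY ht]
    simpa using (hX t ht).rho_mul_exp_le ht.1 fun r hr =>
      hM _ (hXK r ⟨hr.1, hr.2.trans ht.2⟩)
  have hYTmem : Y T ∈ Q.carrier := Q.mem_carrier_of_pos hYTK.1
    (pos_of_mul_pos_left (lt_of_lt_of_le (hself 0 h0).1 hρ) (Real.exp_pos _).le)
  refine ⟨Y, ⟨hYcont, fun t ht => ?_, fun t ht => ?_⟩, hXY⟩
  · rcases ht.2.eq_or_lt with rfl | htT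
    · exact hYTmem
    · rw [← hXY ⟨ht.1, htT⟩]
      exact hself t ⟨ht.1, htT⟩
  · obtain ⟨q, htq, hqT⟩ := exists_between ht.2
    have h1 := (hX q ⟨ht.1.trans htq.le, hqT⟩).hasDeriv t ⟨ht.1, htq⟩
    rw [← hXY ht]
    refine h1.congr_of_eventuallyEq ?_ (hXY ht).symm
    filter_upwards [Ico_mem_nhdsGE ht.2] with r hr
    exact (hXY ⟨ht.1.trans hr.1, hr.2⟩).symm

/-- Two solutions, the second of which starts where the first one ends, can be joined. -/
lemma IsRightSolution.concat {Y Z : ℝ → State} {T t : ℝ} (hT : 0 ≤ T)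
    (hY : IsRightSolution Q u₁ u₂ Y 0 T) (hZ : ∀ t, 0 ≤ t → IsRightSolution Q u₁ u₂ Z 0 t)
    (hYZ : Z 0 = Y T) (ht : 0 ≤ t) :
    IsRightSolution Q u₁ u₂ (fun r => if r < T then Y r else Z (r - T)) 0 t := by
  set X : ℝ → State := fun r => if r < T then Y r else Z (r - T) with hXdef
  have hXlt : ∀ {r}, r < T → X r = Y r := fun hr => if_pos hr
  have hXge : ∀ {r}, T ≤ r → X r = Z (r - T) := fun hr => if_neg (not_lt.2 hr)
  have hXle : ∀ r ∈ Icc 0 T, X r = Y r := fun r hr => by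
    rcases hr.2.eq_or_lt with rfl | h
    · rw [hXge le_rfl, sub_self, hYZ]
    · exact hXlt h
  have h1 : ContinuousOn X (Icc 0 T) := hY.continuousOn.congr hXle
  have h2 : ContinuousOn X (Icc T (T + t)) :=
    ((hZ t ht).continuousOn.comp (continuousOn_id.sub continuousOn_const) fun r hr =>
      ⟨sub_nonneg.2 hr.1, sub_le_iff_le_add'.2 hr.2⟩).congr fun r hr => hXge hr.1
  refine ⟨?_, fun r hr => ?_, fun r hr => ?_⟩
  · refine (h1.union_of_isClosed h2 isClosed_Icc isClosed_Icc).mono fun r hr => ?_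
    rcases le_total r T with h | h
    · exact Or.inl ⟨hr.1, h⟩
    · exact Or.inr ⟨h, by linarith [hr.2]⟩
  · rcases lt_or_ge r T with h | h
    · rw [hXlt h]
      exact hY.mem r ⟨hr.1, h.le⟩
    · rw [hXge h]
      exact (hZ t ht).mem _ ⟨sub_nonneg.2 h, by linarith [hr.2]⟩
  · rcases lt_or_ge r T with h | h
    · rw [hXlt h]
      refine (hY.hasDeriv r ⟨hr.1, h⟩).congr_of_eventuallyEq ?_ (hXlt h)
      filter_upwards [Ico_mem_nhdsGE h] with s hs using hXlt hs.2
    · rw [hXge h]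
      have hd := (hZ t ht).hasDeriv (r - T) ⟨sub_nonneg.2 h, by linarith [hr.2]⟩
      have hs : HasDerivWithinAt (fun s : ℝ => s - T) 1 (Ici r) r :=
        ((hasDerivAt_id r).sub_const T).hasDerivWithinAt
      have hcomp := hd.scomp r hs fun s hs => sub_le_sub_right hs T
      rw [one_smul] at hcomp
      exact hcomp.congr (fun s hs => hXge (h.trans hs)) (hXge h)

/-- A descent feedback is forward complete. -/
theorem IsDescentFeedback.isForwardComplete (hV : IsStrictCLF Q V)
    (hk : IsDescentFeedback Q V k u₁ u₂) : IsForwardComplete Q k := by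
  refine ⟨fun Ξ₀ hΞ₀ => ?_, fun T X hT hX => ?_⟩
  · obtain ⟨X, hX0, hX⟩ := hk.exists_isRightSolution hV hΞ₀
    exact ⟨X, hX0, hk.isClosedLoop_of_isRightSolution fun t ht => hX t ht.1⟩
  · have hmem : ∀ t, t ∈ halfOpen (T : EReal) ↔ t ∈ Ico 0 T := fun t => by
      simp [halfOpen]
    obtain ⟨Y, hY, hXY⟩ := hk.exists_isRightSolution_closure hV hT
      fun t ht => hk.isRightSolution_of_isClosedLoop hX ((hmem t).2 ht)
    obtain ⟨Z, hZ0, hZ⟩ := hk.exists_isRightSolution hV (hY.mem T (right_mem_Icc.2 hT.le))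
    refine ⟨fun r => if r < T then Y r else Z (r - T),
      hk.isClosedLoop_of_isRightSolution fun t ht => hY.concat hT.le hZ hZ0 ht.1, fun t ht => ?_⟩
    have ht' := (hmem t).1 ht
    simp only [if_pos ht'.2]
    exact hXY ht'

/-- A descent feedback renders the target globally asymptotically stable: `V` does not increase,
which gives stability, and decreases at a uniform rate as long as it is bounded below, which gives
uniform attractivity. -/
theorem IsDescentFeedback.isGAS (hV : IsStrictCLF Q V)
    (hk : IsDescentFeedback Q V k u₁ u₂) : IsGAS Q k := by
  refine ⟨hk.isForwardComplete hV, ?_⟩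
  obtain ⟨α₁, α₂, h₁, h₂, h⟩ := hV.bounds
  have htop : ∀ {r : ℝ}, 0 ≤ r → r ∈ halfOpen ⊤ := mem_halfOpen_top.2
  have hsize : ∀ Ξ, Q.size Ξ ∈ halfOpen ⊤ := fun Ξ => htop (Q.size_nonneg Ξ)
  have hsol : ∀ {X : ℝ → State}, IsClosedLoop Q k ⊤ X → ∀ {t : ℝ}, 0 ≤ t →
      IsRightSolution Q u₁ u₂ X 0 t := fun hX _ ht =>
    hk.isRightSolution_of_isClosedLoop hX (htop ht)
  have hext : ∀ {X : ℝ → State}, IsClosedLoop Q k ⊤ X → ∀ {t : ℝ}, 0 ≤ t →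
      X t ∈ Q.extended := fun hX _ ht => Q.carrier_subset_extended (hX.mem _ (htop ht))
  have hdecr : ∀ {X : ℝ → State}, IsClosedLoop Q k ⊤ X → ∀ {t : ℝ}, 0 ≤ t →
      α₁ (Q.size (X t)) ≤ α₂ (Q.size (X 0)) := fun hX _ ht =>
    (h _ (hext hX ht)).1.trans (((hsol hX ht).le_of_le hV hk ht).trans (h _ (hext hX le_rfl)).2)
  refine (exists_isClassKL_bound
    (𝓕 := {x | ∃ X : ℝ → State, IsClosedLoop Q k ⊤ X ∧ x = fun t => Q.size (X t)})
    ?_ ?_ ?_ ?_).imp fun β hβ => ⟨hβ.1, fun X hX t ht => hβ.2 _ ⟨X, hX, rfl⟩ t ht⟩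
  · rintro x ⟨X, -, rfl⟩
    exact Q.size_nonneg _
  · intro s
    obtain ⟨R, hR, hsR⟩ := h₁.unbounded (α₂ |s|)
    refine ⟨R, ?_⟩
    rintro x ⟨X, hX, rfl⟩ hxs t ht
    refine (h₁.strictMonoOn.lt_iff_lt (hsize _) hR).1 (lt_of_le_of_lt ?_ hsR) |>.le
    exact (hdecr hX ht).trans (h₂.strictMonoOn.monotoneOn (hsize _) (htop (abs_nonneg s))
      (hxs.trans (le_abs_self s)))
  · intro ε hε
    have hpos : 0 < α₁ ε := by
      rw [← h₁.map_zero]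
      exact h₁.strictMonoOn (htop le_rfl) (htop hε.le) hε
    have hcont : Tendsto α₂ (𝓝[halfOpen ⊤] 0) (𝓝 0) := by
      have := h₂.continuousOn 0 (htop le_rfl)
      rwa [ContinuousWithinAt, h₂.map_zero] at this
    obtain ⟨δ, hδ, hlt⟩ := Metric.tendsto_nhdsWithin_nhds.1 hcont _ hpos
    refine ⟨δ / 2, half_pos hδ, ?_⟩
    rintro x ⟨X, hX, rfl⟩ hxs t ht
    have hsmall := hlt (htop (Q.size_nonneg (X 0))) (by
      rw [Real.dist_eq, sub_zero, abs_of_nonneg (Q.size_nonneg _)]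
      exact hxs.trans_lt (half_lt_self hδ))
    rw [Real.dist_eq, sub_zero] at hsmall
    refine (h₁.strictMonoOn.lt_iff_lt (hsize _) (htop hε.le)).1 ?_ |>.le
    exact ((hdecr hX ht).trans (le_abs_self _)).trans_lt hsmall
  · intro s ε hε
    have hpos : 0 < α₁ ε := by
      rw [← h₁.map_zero]
      exact h₁.strictMonoOn (htop le_rfl) (htop hε.le) hε
    have hC : 0 ≤ α₂ |s| := by
      rw [← h₂.map_zero]
      exact h₂.strictMonoOn.monotoneOn (htop le_rfl) (htop (abs_nonneg s)) (abs_nonneg s)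
    obtain ⟨m, hm, hrate⟩ := hk.exists_descentRate_le hV (C := α₂ |s|) hpos
    -- At the rate `m` the function `V` would reach `0` by the time `α₂ |s| / m`.
    refine ⟨α₂ |s| / m, by positivity, ?_⟩
    rintro x ⟨X, hX, rfl⟩ hxs t ht
    have ht0 : 0 ≤ t := le_trans (by positivity) ht
    by_contra! hlt
    have hVt : α₁ ε < V (X t) :=
      (h₁.strictMonoOn (htop hε.le) (hsize _) hlt).trans_le (h _ (hext hX ht0)).1
    have hV0 : V (X 0) ≤ α₂ |s| := (h _ (hext hX le_rfl)).2.trans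
      (h₂.strictMonoOn.monotoneOn (hsize _) (htop (abs_nonneg s)) (hxs.trans (le_abs_self s)))
    have hfinal := (hsol hX ht0).le_sub_mul hV ht0 (m := m) fun r hr =>
      hrate _ (hext hX hr.1)
        (hVt.le.trans (((hsol hX ht0).mono hr.1 le_rfl).le_of_le hV hk hr.2.le))
        (((hsol hX hr.1).le_of_le hV hk hr.1).trans hV0)
    have : α₂ |s| ≤ m * t := by
      rw [div_le_iff₀ hm] at ht
      linarith
    linarith

end Completeness

/-! ### The cost along trajectories -/

section Cost

variable {a : EReal} {η : ℝ → ℝ}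

/-- The Fenchel–Young inequality for the extended penalty, with a scaling `ε`. -/
lemma IsControlPenalty.ofReal_abs_mul_le (hη : IsControlPenalty a η) {ε : ℝ} (hε : 0 < ε)
    (ν u : ℝ) : ENNReal.ofReal |ν * u| ≤
      ENNReal.ofReal (legendre a η (ε * |ν|)) + penalty a η (|u| / ε) := by
  have hb : 0 ≤ ε * |ν| := by positivity
  rw [penalty]
  split_ifs with h
  · have hx : |u| / ε ∈ halfOpen a := ⟨by positivity, h⟩
    rw [← ENNReal.ofReal_add (hη.legendre_nonneg hb) (hη.nonneg hx)]
    refine ENNReal.ofReal_le_ofReal ?_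
    have := hη.mul_le_add_legendre hb hx
    have heq : |ν * u| = ε * |ν| * (|u| / ε) := by
      rw [abs_mul]
      field_simp
    linarith
  · simp

/-- Equality holds in the Fenchel–Young inequality for the control `-ε (η')⁻¹(ε |ν|) sgn ν`. -/
lemma IsControlPenalty.ofReal_legendre_add_penalty (hη : IsControlPenalty a η) {ε : ℝ}
    (hε : 0 < ε) (ν : ℝ) :
    ENNReal.ofReal (legendre a η (ε * |ν|)) +
      penalty a η (|-(ε * oddInv a η (ε * ν))| / ε) =
      ENNReal.ofReal (-(ν * -(ε * oddInv a η (ε * ν)))) := by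
  have habs : |ε * ν| = ε * |ν| := by rw [abs_mul, abs_of_pos hε]
  have hb : 0 ≤ ε * |ν| := by positivity
  have hp := hη.dEtaInv_mem hb
  have h1 : |-(ε * oddInv a η (ε * ν))| / ε = dEtaInv a η (ε * |ν|) := by
    rw [abs_neg, abs_mul, abs_of_pos hε, abs_oddInv hη, habs, mul_div_cancel_left₀ _ hε.ne']
  have h2 : -(ν * -(ε * oddInv a η (ε * ν))) = ε * |ν| * dEtaInv a η (ε * |ν|) := by
    rw [mul_neg, neg_neg, ← mul_assoc, mul_comm ν ε, mul_oddInv, habs]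
  rw [h1, h2, penalty, if_pos hp.2, ← ENNReal.ofReal_add (hη.legendre_nonneg hb) (hη.nonneg hp),
    hη.legendre_eq hb]
  ring_nf

namespace Design

variable {D : Design}

/-- The running cost at the state `Ξ` under the inputs `v` and `ω`. -/
def runningCost (D : Design) (Ξ : State) (v ω : ℝ) : ENNReal :=
  ENNReal.ofReal (D.stateCost Ξ) + penalty D.a₁ D.η₁ (|v| / (D.ε₁ Ξ * Ξ.1)) +
    penalty D.a₂ D.η₂ (|ω| / D.ε₂ Ξ)

/-- The assumptions on the data of the design. -/
structure IsAdmissible (D : Design) : Prop where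
  clf : IsStrictCLF D.Q D.V
  penalty₁ : IsControlPenalty D.a₁ D.η₁
  penalty₂ : IsControlPenalty D.a₂ D.η₂
  continuousOn₁ : ContinuousOn D.ε₁ D.Q.extended
  continuousOn₂ : ContinuousOn D.ε₂ D.Q.extended
  pos₁ : ∀ Ξ ∈ D.Q.extended, 0 < D.ε₁ Ξ
  pos₂ : ∀ Ξ ∈ D.Q.extended, 0 < D.ε₂ Ξ

namespace IsAdmissible

lemma continuousOn_ν₁ (hD : D.IsAdmissible) : ContinuousOn D.ν₁ D.Q.extended :=
  hD.clf.continuousOn_lieDeriv continuous_g1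

lemma continuousOn_ν₂ (hD : D.IsAdmissible) : ContinuousOn D.ν₂ D.Q.extended :=
  hD.clf.continuousOn_lieDeriv continuous_g2

lemma ν_ne_zero (hD : D.IsAdmissible) {Ξ : State} (hΞ : Ξ ∈ D.Q.extended) (h0 : Ξ ≠ 0) :
    D.ν₁ Ξ ≠ 0 ∨ D.ν₂ Ξ ≠ 0 := by
  by_contra! h
  obtain ⟨u₁, u₂, hu⟩ := hD.clf.decrease Ξ hΞ h0
  change D.ν₁ Ξ * u₁ + D.ν₂ Ξ * u₂ < 0 at hu
  simp [h.1, h.2] at hu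

/-- Odd continuous functions of `εᵢ νᵢ` with the sign of their argument give descent feedbacks. -/
lemma isDescentFeedback (hD : D.IsAdmissible) {k : State → ℝ × ℝ} {φ₁ φ₂ : ℝ → ℝ}
    (hφ₁ : Continuous φ₁) (hφ₂ : Continuous φ₂) (hs₁ : ∀ x, x ≠ 0 → 0 < x * φ₁ x)
    (hs₂ : ∀ x, x ≠ 0 → 0 < x * φ₂ x)
    (hk : ∀ Ξ ∈ D.Q.extended, k Ξ = (Ξ.1 * -(D.ε₁ Ξ * φ₁ (D.ε₁ Ξ * D.ν₁ Ξ)),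
      -(D.ε₂ Ξ * φ₂ (D.ε₂ Ξ * D.ν₂ Ξ)))) :
    IsDescentFeedback D.Q D.V k (fun Ξ => -(D.ε₁ Ξ * φ₁ (D.ε₁ Ξ * D.ν₁ Ξ)))
      (fun Ξ => -(D.ε₂ Ξ * φ₂ (D.ε₂ Ξ * D.ν₂ Ξ))) := by
  refine ⟨?_, ?_, hk, fun Ξ hΞ h0 => ?_⟩
  · exact (hD.continuousOn₁.mul (hφ₁.comp_continuousOn
      (hD.continuousOn₁.mul hD.continuousOn_ν₁))).neg
  · exact (hD.continuousOn₂.mul (hφ₂.comp_continuousOn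
      (hD.continuousOn₂.mul hD.continuousOn_ν₂))).neg
  · have hle : ∀ {φ : ℝ → ℝ}, (∀ x, x ≠ 0 → 0 < x * φ x) → ∀ x, 0 ≤ x * φ x := fun h x => by
      rcases eq_or_ne x 0 with rfl | hx
      · simp
      · exact (h x hx).le
    have hrate : descentRate D.Q D.V (fun Ξ => -(D.ε₁ Ξ * φ₁ (D.ε₁ Ξ * D.ν₁ Ξ)))
        (fun Ξ => -(D.ε₂ Ξ * φ₂ (D.ε₂ Ξ * D.ν₂ Ξ))) Ξ
        = -(D.ε₁ Ξ * D.ν₁ Ξ * φ₁ (D.ε₁ Ξ * D.ν₁ Ξ) + D.ε₂ Ξ * D.ν₂ Ξ * φ₂ (D.ε₂ Ξ * D.ν₂ Ξ)) := by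
      simp only [descentRate, ν₁, ν₂]
      ring
    rw [hrate, neg_lt_zero]
    rcases hD.ν_ne_zero hΞ h0 with h | h
    · exact add_pos_of_pos_of_nonneg (hs₁ _ (mul_ne_zero (hD.pos₁ Ξ hΞ).ne' h)) (hle hs₂ _)
    · exact add_pos_of_nonneg_of_pos (hle hs₁ _) (hs₂ _ (mul_ne_zero (hD.pos₂ Ξ hΞ).ne' h))

lemma isDescentFeedback_optimal (hD : D.IsAdmissible) :
    IsDescentFeedback D.Q D.V D.optimalFeedback
      (fun Ξ => -(D.ε₁ Ξ * oddInv D.a₁ D.η₁ (D.ε₁ Ξ * D.ν₁ Ξ)))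
      (fun Ξ => -(D.ε₂ Ξ * oddInv D.a₂ D.η₂ (D.ε₂ Ξ * D.ν₂ Ξ))) := by
  refine hD.isDescentFeedback (continuous_oddInv hD.penalty₁) (continuous_oddInv hD.penalty₂)
    (fun x hx => ?_) (fun x hx => ?_) fun Ξ hΞ => ?_
  · rw [mul_oddInv]
    exact mul_pos (abs_pos.2 hx) (hD.penalty₁.dEtaInv_pos (abs_pos.2 hx))
  · rw [mul_oddInv]
    exact mul_pos (abs_pos.2 hx) (hD.penalty₂.dEtaInv_pos (abs_pos.2 hx))
  · have h₁ := hD.pos₁ Ξ hΞ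
    have h₂ := hD.pos₂ Ξ hΞ
    simp only [optimalFeedback, oddInv, sign_pos_mul h₁, sign_pos_mul h₂, abs_mul, abs_of_pos h₁,
      abs_of_pos h₂]
    ext <;> ring

lemma stabilizingLaw_eq (hD : D.IsAdmissible) {Ξ : State} (hΞ : Ξ ∈ D.Q.extended) (n : ℝ × ℝ) :
    D.stabilizingLaw Ξ n = (Ξ.1 * -(D.ε₁ Ξ * oddRatio D.a₁ D.η₁ (D.ε₁ Ξ * n.1)),
      -(D.ε₂ Ξ * oddRatio D.a₂ D.η₂ (D.ε₂ Ξ * n.2))) := by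
  have h₁ := hD.pos₁ Ξ hΞ
  have h₂ := hD.pos₂ Ξ hΞ
  simp only [stabilizingLaw, oddRatio, sign_pos_mul h₁, sign_pos_mul h₂, abs_mul, abs_of_pos h₁,
    abs_of_pos h₂]
  ext <;> ring

lemma isDescentFeedback_stabilizing (hD : D.IsAdmissible) :
    IsDescentFeedback D.Q D.V D.stabilizingFeedback
      (fun Ξ => -(D.ε₁ Ξ * oddRatio D.a₁ D.η₁ (D.ε₁ Ξ * D.ν₁ Ξ)))
      (fun Ξ => -(D.ε₂ Ξ * oddRatio D.a₂ D.η₂ (D.ε₂ Ξ * D.ν₂ Ξ))) := by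
  refine hD.isDescentFeedback (continuous_oddRatio hD.penalty₁) (continuous_oddRatio hD.penalty₂)
    (fun x hx => ?_) (fun x hx => ?_) fun Ξ hΞ => hD.stabilizingLaw_eq hΞ _
  · rw [mul_oddRatio]
    exact hD.penalty₁.legendre_pos (abs_pos.2 hx)
  · rw [mul_oddRatio]
    exact hD.penalty₂.legendre_pos (abs_pos.2 hx)

/-- The state cost is the rate at which the stabilizing feedback decreases `V`. -/
lemma descentRate_stabilizing (hD : D.IsAdmissible) {Ξ : State} (hΞ : Ξ ∈ D.Q.extended) :
    descentRate D.Q D.V (fun Ξ => -(D.ε₁ Ξ * oddRatio D.a₁ D.η₁ (D.ε₁ Ξ * D.ν₁ Ξ)))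
      (fun Ξ => -(D.ε₂ Ξ * oddRatio D.a₂ D.η₂ (D.ε₂ Ξ * D.ν₂ Ξ))) Ξ = -D.stateCost Ξ := by
  have h₁ := mul_oddRatio (a := D.a₁) (η := D.η₁) (D.ε₁ Ξ * D.ν₁ Ξ)
  have h₂ := mul_oddRatio (a := D.a₂) (η := D.η₂) (D.ε₂ Ξ * D.ν₂ Ξ)
  rw [abs_mul, abs_of_pos (hD.pos₁ Ξ hΞ)] at h₁
  rw [abs_mul, abs_of_pos (hD.pos₂ Ξ hΞ)] at h₂
  rw [stateCost, ← h₁, ← h₂]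
  simp only [descentRate, ν₁, ν₂]
  ring

lemma ofReal_stateCost (hD : D.IsAdmissible) {Ξ : State} (hΞ : Ξ ∈ D.Q.extended) :
    ENNReal.ofReal (D.stateCost Ξ) =
      ENNReal.ofReal (legendre D.a₁ D.η₁ (D.ε₁ Ξ * |D.ν₁ Ξ|)) +
        ENNReal.ofReal (legendre D.a₂ D.η₂ (D.ε₂ Ξ * |D.ν₂ Ξ|)) :=
  ENNReal.ofReal_add
    (hD.penalty₁.legendre_nonneg (mul_nonneg (hD.pos₁ Ξ hΞ).le (abs_nonneg _)))
    (hD.penalty₂.legendre_nonneg (mul_nonneg (hD.pos₂ Ξ hΞ).le (abs_nonneg _)))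

lemma abs_div_eps_mul (hD : D.IsAdmissible) {Ξ : State} (hΞ : Ξ ∈ D.Q.carrier) (v : ℝ) :
    |v| / (D.ε₁ Ξ * Ξ.1) = |v / Ξ.1| / D.ε₁ Ξ := by
  have hρ : 0 < Ξ.1 := hΞ.1
  have hε := hD.pos₁ Ξ (D.Q.carrier_subset_extended hΞ)
  rw [abs_div, abs_of_pos hρ, div_div, mul_comm]

/-- Whatever the inputs, the running cost bounds the rate of change of `V`. -/
lemma ofReal_abs_le_runningCost (hD : D.IsAdmissible) {Ξ : State} (hΞ : Ξ ∈ D.Q.carrier)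
    (v ω : ℝ) :
    ENNReal.ofReal |fderiv ℝ D.V Ξ (field Ξ v ω)| ≤ D.runningCost Ξ v ω := by
  have hext := D.Q.carrier_subset_extended hΞ
  have hderiv : fderiv ℝ D.V Ξ (field Ξ v ω) = D.ν₁ Ξ * (v / Ξ.1) + D.ν₂ Ξ * ω := by
    rw [(hD.clf.hasFDerivAt hΞ).fderiv]
    simp only [field, ν₁, ν₂, lieDeriv, map_add, map_smul, smul_eq_mul]
    ring
  rw [hderiv, runningCost, hD.ofReal_stateCost hext, hD.abs_div_eps_mul hΞ]
  refine (ENNReal.ofReal_le_ofReal (abs_add_le _ _)).trans ?_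
  rw [ENNReal.ofReal_add (abs_nonneg _) (abs_nonneg _)]
  refine (add_le_add (hD.penalty₁.ofReal_abs_mul_le (hD.pos₁ Ξ hext) _ _)
    (hD.penalty₂.ofReal_abs_mul_le (hD.pos₂ Ξ hext) _ _)).trans_eq ?_
  ring

/-- Under the optimal feedback the running cost is the rate of decrease of `V`. -/
lemma runningCost_optimal (hD : D.IsAdmissible) {Ξ : State} (hΞ : Ξ ∈ D.Q.carrier) :
    D.runningCost Ξ (D.optimalFeedback Ξ).1 (D.optimalFeedback Ξ).2 = ENNReal.ofReal
      (-descentRate D.Q D.V (fun Ξ => -(D.ε₁ Ξ * oddInv D.a₁ D.η₁ (D.ε₁ Ξ * D.ν₁ Ξ)))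
        (fun Ξ => -(D.ε₂ Ξ * oddInv D.a₂ D.η₂ (D.ε₂ Ξ * D.ν₂ Ξ))) Ξ) := by
  have hext := D.Q.carrier_subset_extended hΞ
  have hρ : Ξ.1 ≠ 0 := ne_of_gt hΞ.1
  have hnn : ∀ {a : EReal} {η : ℝ → ℝ}, IsControlPenalty a η → ∀ {ε : ℝ}, 0 < ε → ∀ ν : ℝ,
      0 ≤ -(ν * -(ε * oddInv a η (ε * ν))) := fun {a η} hη {ε} hε ν => by
    have h := mul_oddInv (a := a) (η := η) (ε * ν)
    have h0 := mul_nonneg (abs_nonneg (ε * ν)) (hη.dEtaInv_mem (abs_nonneg (ε * ν))).1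
    linarith
  rw [runningCost, hD.abs_div_eps_mul hΞ, hD.ofReal_stateCost hext,
    hD.isDescentFeedback_optimal.eq_on Ξ hext, mul_div_cancel_left₀ _ hρ]
  change _ = ENNReal.ofReal
    (-(D.ν₁ Ξ * -(D.ε₁ Ξ * oddInv D.a₁ D.η₁ (D.ε₁ Ξ * D.ν₁ Ξ)) +
      D.ν₂ Ξ * -(D.ε₂ Ξ * oddInv D.a₂ D.η₂ (D.ε₂ Ξ * D.ν₂ Ξ))))
  rw [neg_add, ENNReal.ofReal_add (hnn hD.penalty₁ (hD.pos₁ Ξ hext) _)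
      (hnn hD.penalty₂ (hD.pos₂ Ξ hext) _),
    ← hD.penalty₁.ofReal_legendre_add_penalty (hD.pos₁ Ξ hext),
    ← hD.penalty₂.ofReal_legendre_add_penalty (hD.pos₂ Ξ hext)]
  ring

/-- Along an optimal trajectory, the cost is at most the initial value of `V`. -/
lemma cost_optimal_le (hD : D.IsAdmissible) {X : ℝ → State}
    (hX : IsClosedLoop D.Q D.optimalFeedback ⊤ X) :
    D.cost X (fun t => (D.optimalFeedback (X t)).1) (fun t => (D.optimalFeedback (X t)).2)
      ≤ ENNReal.ofReal (D.V (X 0)) := by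
  have hk := hD.isDescentFeedback_optimal
  set u₁ : State → ℝ := fun Ξ => -(D.ε₁ Ξ * oddInv D.a₁ D.η₁ (D.ε₁ Ξ * D.ν₁ Ξ)) with hu₁
  set u₂ : State → ℝ := fun Ξ => -(D.ε₂ Ξ * oddInv D.a₂ D.η₂ (D.ε₂ Ξ * D.ν₂ Ξ)) with hu₂
  have hmem : ∀ t, 0 ≤ t → X t ∈ D.Q.carrier := fun t ht =>
    hX.mem t (mem_halfOpen_top.2 ht)
  have hcost : D.cost X (fun t => (D.optimalFeedback (X t)).1)
      (fun t => (D.optimalFeedback (X t)).2)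
      = ∫⁻ t in Ici (0 : ℝ), ENNReal.ofReal (-descentRate D.Q D.V u₁ u₂ (X t)) :=
    setLIntegral_congr_fun measurableSet_Ici fun t ht => hD.runningCost_optimal (hmem t ht)
  have hunion : Ici (0 : ℝ) = ⋃ n : ℕ, Icc 0 (n : ℝ) := by
    ext t
    simp only [mem_Ici, mem_iUnion, mem_Icc, exists_and_left]
    exact ⟨fun h => ⟨h, exists_nat_ge t⟩, fun h => h.1⟩
  rw [hcost, hunion, setLIntegral_iUnion_of_directed _ (Monotone.directed_le fun m n hmn =>
    Icc_subset_Icc_right (Nat.cast_le.2 hmn))]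
  refine iSup_le fun n => ?_
  have hn : (0 : ℝ) ≤ n := n.cast_nonneg
  have hsol := hk.isRightSolution_of_isClosedLoop hX (mem_halfOpen_top.2 hn)
  have hcont : ContinuousOn (fun t => descentRate D.Q D.V u₁ u₂ (X t)) (Icc 0 (n : ℝ)) :=
    (hk.continuousOn_descentRate hD.clf).comp hsol.continuousOn
      fun t ht => D.Q.carrier_subset_extended (hsol.mem t ht)
  have hneg : ∀ t ∈ Icc 0 (n : ℝ), 0 ≤ -descentRate D.Q D.V u₁ u₂ (X t) := fun t ht =>
    neg_nonneg.2 (hk.descentRate_neg _ (D.Q.carrier_subset_extended (hsol.mem t ht))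
      (D.Q.ne_zero_of_mem_carrier (hsol.mem t ht))).le
  have hint : IntegrableOn (fun t => -descentRate D.Q D.V u₁ u₂ (X t)) (Icc 0 (n : ℝ)) :=
    hcont.neg.integrableOn_Icc
  rw [← ofReal_integral_eq_lintegral_ofReal hint
    ((ae_restrict_iff' measurableSet_Icc).2 (ae_of_all _ hneg)), integral_neg,
    integral_Icc_eq_integral_Ioc, ← intervalIntegral.integral_of_le hn,
    intervalIntegral.integral_eq_sub_of_hasDeriv_right_of_le hn (hsol.continuousOn_comp hD.clf)
      (fun r hr => (hsol.hasDeriv_comp hD.clf (Ioo_subset_Ico_self hr)).mono Ioi_subset_Ici_self)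
      (hcont.intervalIntegrable_of_Icc hn)]
  refine ENNReal.ofReal_le_ofReal ?_
  linarith [hD.clf.nonneg (D.Q.carrier_subset_extended (hmem n hn))]

/-- The initial value of `V` is a lower bound for the cost of every trajectory. A finite cost bounds
the variation of `V`; if it were less than the initial value, `V` would stay bounded and bounded
below by a positive constant, and the state cost would have an infinite integral. -/
lemma ofReal_le_cost (hD : D.IsAdmissible) {X : ℝ → State} {v ω : ℝ → ℝ}
    (hX : IsTrajectory D.Q ⊤ X v ω) : ENNReal.ofReal (D.V (X 0)) ≤ D.cost X v ω := by
  have htop : ∀ {t : ℝ}, 0 ≤ t → t ∈ halfOpen ⊤ := mem_halfOpen_top.2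
  have hmem : ∀ t, 0 ≤ t → X t ∈ D.Q.carrier := fun t ht => hX.mem t (htop ht)
  have hext : ∀ t, 0 ≤ t → X t ∈ D.Q.extended := fun t ht =>
    D.Q.carrier_subset_extended (hmem t ht)
  by_contra! hlt
  set J := D.cost X v ω with hJ
  have hJtop : J ≠ ⊤ := hlt.ne_top
  have hJV : J.toReal < D.V (X 0) := by
    rwa [← ENNReal.ofReal_toReal hJtop, ENNReal.ofReal_lt_ofReal_iff_of_nonneg
      ENNReal.toReal_nonneg] at hlt
  have hvar : ∀ T, 0 ≤ T → |D.V (X T) - D.V (X 0)| ≤ J.toReal := by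
    intro T hT
    obtain ⟨hint, heq⟩ := integral_fderiv_comp_eq_sub D.Q.isOpen_carrier
      (hD.clf.contDiffOn.mono D.Q.carrier_subset_extended) hT (hX.integrable T (htop hT))
      (fun t ht => hX.eq_integral t (htop ht.1)) (fun t ht => hmem t ht.1)
    rw [← heq]
    refine intervalIntegral.abs_integral_le_integral_abs hT |>.trans ?_
    rw [← ENNReal.ofReal_le_iff_le_toReal hJtop, intervalIntegral.integral_of_le hT,
      ofReal_integral_eq_lintegral_ofReal
        ((intervalIntegrable_iff_integrableOn_Ioc_of_le hT).1 hint).abs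
        (ae_of_all _ fun t => abs_nonneg _)]
    refine (setLIntegral_mono' measurableSet_Ioc fun t ht =>
      hD.ofReal_abs_le_runningCost (hmem t ht.1.le) (v t) (ω t)).trans ?_
    exact lintegral_mono_set fun t ht => ht.1.le
  obtain ⟨m, hm, hrate⟩ := hD.isDescentFeedback_stabilizing.exists_descentRate_le hD.clf
    (c := D.V (X 0) - J.toReal) (C := D.V (X 0) + J.toReal) (sub_pos.2 hJV)
  have hlow : ∀ t, 0 ≤ t → ENNReal.ofReal m ≤ D.runningCost (X t) (v t) (ω t) := by
    intro t ht
    obtain ⟨h1, h2⟩ := abs_le.1 (hvar t ht)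
    have h3 := hrate (X t) (hext t ht) (by linarith) (by linarith)
    rw [hD.descentRate_stabilizing (hext t ht)] at h3
    rw [runningCost, add_assoc]
    exact (ENNReal.ofReal_le_ofReal (neg_le_neg_iff.1 h3)).trans le_self_add
  have hinf : ∫⁻ _ in Ici (0 : ℝ), ENNReal.ofReal m ≤ J :=
    setLIntegral_mono' measurableSet_Ici fun t ht => hlow t ht
  rw [setLIntegral_const, Real.volume_Ici, ENNReal.mul_top (ENNReal.ofReal_pos.2 hm).ne',
    top_le_iff] at hinf
  exact hJtop hinf

end IsAdmissible

end Design

end Cost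

end Unicycle

end

theorem mainTheorem3 (D : Unicycle.Design)
    (hV : Unicycle.IsStrictCLF D.Q D.V)
    (ha₁ : 0 < D.a₁) (ha₂ : 0 < D.a₂)
    (hη₁ : Unicycle.IsControlPenalty D.a₁ D.η₁)
    (hη₂ : Unicycle.IsControlPenalty D.a₂ D.η₂)
    (hε₁ : ContinuousOn D.ε₁ D.Q.extended) (hε₁_pos : ∀ Ξ ∈ D.Q.extended, 0 < D.ε₁ Ξ)
    (hε₂ : ContinuousOn D.ε₂ D.Q.extended) (hε₂_pos : ∀ Ξ ∈ D.Q.extended, 0 < D.ε₂ Ξ) :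
    D.IsMinimizedBy D.optimalFeedback ∧
    (∀ Ξ ∈ D.Q.extended, Continuous (D.stabilizingLaw Ξ)) ∧
    ContinuousOn D.stabilizingFeedback D.Q.extended ∧
    Unicycle.IsGAS D.Q D.stabilizingFeedback := by
  have hD : D.IsAdmissible := ⟨hV, hη₁, hη₂, hε₁, hε₂, hε₁_pos, hε₂_pos⟩
  have hstab := hD.isDescentFeedback_stabilizing
  refine ⟨⟨hD.isDescentFeedback_optimal.isForwardComplete hV, fun X hX => ⟨?_, ?_⟩⟩,
    fun Ξ hΞ => ?_, ?_, hstab.isGAS hV⟩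
  · exact (hD.cost_optimal_le hX).trans_lt ENNReal.ofReal_lt_top
  · intro X' v ω hX' h0
    refine (hD.cost_optimal_le hX).trans ?_
    rw [← h0]
    exact hD.ofReal_le_cost hX'
  · have h₁ := Unicycle.continuous_oddRatio hη₁
    have h₂ := Unicycle.continuous_oddRatio hη₂
    rw [funext (hD.stabilizingLaw_eq hΞ)]
    fun_prop
  · exact ((continuousOn_fst.mul hstab.continuousOn_fst).prodMk hstab.continuousOn_snd).congr
      hstab.eq_on
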